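/- Let $\mu\in\mathbb{R}^2$, let $V=(v_{ij})\in\mathbb{R}^{2\times 2}$ be symmetric and positive definite, and let $F$ be a continuous elliptical distribution on $\mathbb{R}^2$ with symmetry center $\mu$ and shape matrix $V$, i.e. $F$ is a probability distribution with a Lebesgue density of the form $$f(x)=\det(V)^{-1/2}\,g\big((x-\mu)^T V^{-1}(x-\mu)\big)$$ for some measurable $g\ge 0$ (the elliptical generator). Assume that $F$ has a density that is bounded in a neighbourhood of $\mu$. Put $$\rho=\frac{v_{12}}{\sqrt{v_{11}v_{22}}},\qquad a=\sqrt{v_{11}/v_{22}}.$$ Let $X_1,X_2,\dots$ be i.i.d. random vectors with distribution $F$, and for each $n$ let $\hat\mu_n$ be an empirical spatial median of $X_1,\dots,X_n$, i.e. a random vector that almost surely minimizes $m\mapsto\sum_{i=1}^n\|X_i-m\|$ over $m\in\mathbb{R}^2$, where $\|\cdot\|$ is the Euclidean norm. With the spatial sign $s(x)=x/\|x\|$ for $x\ne 0$ and $s(0)=0$, let $$\hat S_n=(\hat s_{ij})=\frac1n\sum_{i=1}^n s(X_i-\hat\mu_n)\,s(X_i-\hat\mu_n)^T$$ be the empirical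 spatial sign covariance matrix, and let $$\hat\rho_n=\frac{c\,\hat s_{12}\,b}{\sqrt{(\hat s_{12}^2+b^2)^2+(\hat s_{12}\,c\,b)^2}},\qquad d=\tfrac12+\sqrt{(\hat s_{11}-\tfrac12)^2+\hat s_{12}^2},\quad c=\frac{2d-1}{d(1-d)},\quad b=d-\hat s_{11},$$ be the spatial sign correlation coefficient (a quotient with denominator $0$ is read as $0$). Then, as $n\to\infty$, 1. $\hat\rho_n\to\rho$ almost surely, and 2. $\displaystyle \sqrt n\,(\hat\rho_n-\rho)\ \xrightarrow{d}\ N\Big(0,\ (1-\rho^2)^2+\tfrac12\,(a+a^{-1})\,(1-\rho^2)^{3/2}\Big).$ In particular the asymptotic variance depends on $F$ only through $\rho$ and $a$, not through the generator $g$. -/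

import Mathlib

open MeasureTheory ProbabilityTheory Filter
open scoped ENNReal NNReal Topology Matrix

noncomputable section

namespace SpatialSign

/-- The class of continuous elliptical distributions on `ℝᵖ` with symmetry center `μ` and shape
matrix `V`: probability measures with a Lebesgue density
`x ↦ det(V)^(-1/2) g((x - μ)ᵀ V⁻¹ (x - μ))`, where `V` is symmetric positive definite and the
generator `g` is some nonnegative function. -/
structure IsElliptical {p : ℕ} (μ : EuclideanSpace ℝ (Fin p)) (V : Matrix (Fin p) (Fin p) ℝ)
    (F : Measure (EuclideanSpace ℝ (Fin p))) : Prop where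
  isProbabilityMeasure : IsProbabilityMeasure F
  posDef : V.PosDef
  exists_generator : ∃ g : ℝ → ℝ, Measurable g ∧ (∀ t, 0 ≤ g t) ∧
    F = volume.withDensity fun x => ENNReal.ofReal
      ((√V.det)⁻¹ * g ((x - μ).ofLp ⬝ᵥ (V⁻¹ *ᵥ (x - μ).ofLp)))

/-- `F` has a Lebesgue density which is bounded in a neighbourhood of the point `μ`. -/
def HasBoundedDensityAt {p : ℕ} (F : Measure (EuclideanSpace ℝ (Fin p)))
    (μ : EuclideanSpace ℝ (Fin p)) : Prop :=
  ∃ f : EuclideanSpace ℝ (Fin p) → ℝ≥0∞, Measurable f ∧ F = volume.withDensity f ∧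
    ∃ C : ℝ≥0, ∀ᶠ x in 𝓝 μ, f x ≤ C

/-- The spatial sign `x / ‖x‖`, equal to `0` at `x = 0` (where `‖x‖⁻¹ = 0`). -/
def spatialSign {p : ℕ} (x : EuclideanSpace ℝ (Fin p)) : EuclideanSpace ℝ (Fin p) :=
  ‖x‖⁻¹ • x

/-- The empirical spatial sign covariance matrix of the sample `x` with location `t`:
the average of `s(xᵢ - t) s(xᵢ - t)ᵀ`. -/
def sscm {p n : ℕ} (x : Fin n → EuclideanSpace ℝ (Fin p)) (t : EuclideanSpace ℝ (Fin p)) :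
    Matrix (Fin p) (Fin p) ℝ :=
  (n : ℝ)⁻¹ • ∑ i, Matrix.vecMulVec (spatialSign (x i - t)).ofLp (spatialSign (x i - t)).ofLp

/-- `m` is an empirical spatial median of the sample `x`: it minimizes `m ↦ ∑ᵢ ‖xᵢ - m‖`.
(It is unique unless the sample lies on a line.) -/
def IsSpatialMedian {p n : ℕ} (x : Fin n → EuclideanSpace ℝ (Fin p))
    (m : EuclideanSpace ℝ (Fin p)) : Prop :=
  ∀ m' : EuclideanSpace ℝ (Fin p), ∑ i, ‖x i - m‖ ≤ ∑ i, ‖x i - m'‖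

/-- The spatial sign correlation coefficient as a function of the entries of the (bivariate) spatial
sign covariance matrix `S`. If `s₁₂ = 0` its value is `0`, also when `b = 0`. -/
def spatialSignCorrelation (S : Matrix (Fin 2) (Fin 2) ℝ) : ℝ :=
  let d : ℝ := 1 / 2 + √((S 0 0 - 1 / 2) ^ 2 + S 0 1 ^ 2)
  let c : ℝ := (2 * d - 1) / (d * (1 - d))
  let b : ℝ := d - S 0 0
  c * S 0 1 * b / √((S 0 1 ^ 2 + b ^ 2) ^ 2 + (S 0 1 * c * b) ^ 2)

/-- The generalized correlation coefficient `v₁₂ / √(v₁₁ v₂₂)` of the shape matrix `V`. -/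
def generalizedCorrelation (V : Matrix (Fin 2) (Fin 2) ℝ) : ℝ :=
  V 0 1 / √(V 0 0 * V 1 1)

/-- The asymptotic variance `(1 - ρ²)² + ½ (a + a⁻¹) (1 - ρ²)^(3/2)`. -/
def asymptoticVariance (ρ a : ℝ) : ℝ :=
  (1 - ρ ^ 2) ^ 2 + 1 / 2 * (a + a⁻¹) * (1 - ρ ^ 2) ^ (3 / 2 : ℝ)

end SpatialSign

end

open scoped ComplexConjugate

namespace SpatialSign

/-! Identify the plane with `ℂ`, centred at `μ`. The first row of the spatial sign covariance matrix
is then an affine function of the mean of the squared sign `w / conj w`, so the estimator is a fixed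
function `correlationOfSignMean` of an average of unimodular numbers.

Population side: with `ζ = signMean V`, the elliptical density depends only on `‖w - ζ * conj w‖`,
so the shear `w ↦ w - ζ * conj w` makes the law rotation invariant. In the sheared variable the
squared sign is a Möbius image of the squared angle, and the mean value property gives the moments
`ζ ^ k` (`circleAverage_moebius_pow`, `hasSignMean_of_density`), whatever the generator. Because the
second moment is the square of the first, the covariance of the squared sign is isotropic, with
variance `(1 - ‖ζ‖ ^ 2) / 2` in each unit direction.

Estimated centre: convexity of the criterion and its strictly positive curvature bound the median by
a multiple of the mean sign (`norm_median_le`). Moving the centre by `m` changes the mean squared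
sign by terms linear in `m`, whose coefficients are averages of odd kernels and tend to `0`, plus a
remainder of smaller order than `‖m‖`, controlled by the finite inverse moment that the bounded
density supplies. The change is therefore negligible against the mean sign, which is of order `n ^
(-1/2)` in probability. All this is pathwise, from countably many strong laws. The central limit
theorem and the delta method (`HasSignMean.asymptotics`) finish, and the gradient at `ζ` gives the
variance by algebra (`quadratic_variance_identity`). -/

/-- The square of the spatial sign of a complex number, `w / conj w`, with the value `-1` at `0`. -/
noncomputable def signSq (w : ℂ) : ℂ := if w = 0 then -1 else w / conj w

/-- The spatial sign of a complex number. -/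
noncomputable def complexSign (w : ℂ) : ℂ := w / (‖w‖ : ℂ)

/-- The mean of `f` over the first `n` terms of the sequence `z`. -/
noncomputable def empMean {E : Type*} [AddCommGroup E] [Module ℝ E] (f : ℂ → E) (z : ℕ → ℂ) (n : ℕ) :
    E :=
  (n : ℝ)⁻¹ • ∑ i ∈ Finset.range n, f (z i)

/-! ### Deterministic estimates along a single sample sequence. -/

lemma signSq_of_ne {w : ℂ} (hw : w ≠ 0) : signSq w = w / conj w := if_neg hw

lemma norm_signSq (w : ℂ) : ‖signSq w‖ = 1 := by
  unfold signSq
  split_ifs with h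
  · simp
  · simp [h]

/-- The kernel bounding the second order remainder of `signSq`. -/
noncomputable def remKernel (η : ℝ) (z : ℂ) : ℝ := ‖z‖⁻¹ * min 1 (2 * η / ‖z‖)

/-- The subtracted bracket is the first-order term of `w / conj w` at `z` in direction `-m`. If `2 *
‖m‖ ≤ ‖z‖` the remainder is an explicit quotient of order `(‖m‖ / ‖z‖) ^ 2`. Otherwise nothing
cancels: the difference of signs is at most `2 ≤ 4 * ‖m‖ / ‖z‖` and the linear term at most `2 * ‖m‖
/ ‖z‖`, whence the `6`. The radius `η` makes the kernel independent of `m`, so that a strong law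
applies to it. -/
lemma norm_signSq_sub_sub_le {z m : ℂ} (hz : z ≠ 0) {η : ℝ} (hm : ‖m‖ ≤ η) :
    ‖signSq (z - m) - signSq z - (conj m * (z / conj z ^ 2) - m * (1 / conj z))‖
      ≤ 6 * ‖m‖ * remKernel η z := by
  have hz' : 0 < ‖z‖ := norm_pos_iff.2 hz
  have hcz : conj z ≠ 0 := by simpa using hz
  unfold remKernel
  rcases le_or_gt (2 * ‖m‖) ‖z‖ with h | h
  · have hge : ‖z‖ / 2 ≤ ‖z - m‖ := by
      have := norm_sub_norm_le z m; linarith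
    have hzm : z - m ≠ 0 := by
      rw [← norm_pos_iff]; linarith
    have hczm : conj (z - m) ≠ 0 := (map_ne_zero _).2 hzm
    rw [signSq_of_ne hz, signSq_of_ne hzm]
    have key : (z - m) / conj (z - m) - z / conj z - (conj m * (z / conj z ^ 2) - m * (1 / conj z))
        = (z * conj m - m * conj z) * conj m / (conj z ^ 2 * conj (z - m)) := by
      have : conj z - conj m ≠ 0 := by rwa [← map_sub]
      rw [map_sub]
      field_simp
      ring
    rw [key, norm_div, norm_mul, norm_mul, norm_pow, RCLike.norm_conj, RCLike.norm_conj,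
      RCLike.norm_conj]
    have h1 : ‖z * conj m - m * conj z‖ ≤ 2 * (‖z‖ * ‖m‖) := by
      refine (norm_sub_le _ _).trans ?_
      simp only [norm_mul, RCLike.norm_conj]
      linarith
    have h2 : ‖m‖ / ‖z‖ ≤ min 1 (2 * η / ‖z‖) := by
      refine le_min ?_ ?_
      · rw [div_le_one hz']; linarith [norm_nonneg m]
      · gcongr; linarith [norm_nonneg m]
    calc ‖z * conj m - m * conj z‖ * ‖m‖ / (‖z‖ ^ 2 * ‖z - m‖)
        ≤ 2 * (‖z‖ * ‖m‖) * ‖m‖ / (‖z‖ ^ 2 * (‖z‖ / 2)) := by gcongr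
      _ = 4 * ‖m‖ * (‖z‖⁻¹ * (‖m‖ / ‖z‖)) := by field_simp; ring
      _ ≤ 6 * ‖m‖ * (‖z‖⁻¹ * min 1 (2 * η / ‖z‖)) := by gcongr; norm_num
  · have hmin : min 1 (2 * η / ‖z‖) = 1 := by
      refine min_eq_left ?_
      rw [le_div_iff₀ hz']; linarith
    rw [hmin, mul_one]
    have h1 : ‖signSq (z - m) - signSq z‖ ≤ 4 * ‖m‖ * ‖z‖⁻¹ := by
      have : ‖signSq (z - m) - signSq z‖ ≤ 2 := by
        refine (norm_sub_le _ _).trans ?_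
        rw [norm_signSq, norm_signSq]; norm_num
      refine this.trans ?_
      rw [← div_eq_mul_inv, le_div_iff₀ hz']
      linarith
    have h2 : ‖conj m * (z / conj z ^ 2) - m * (1 / conj z)‖ ≤ 2 * ‖m‖ * ‖z‖⁻¹ := by
      refine (norm_sub_le _ _).trans (le_of_eq ?_)
      simp only [norm_mul, norm_div, RCLike.norm_conj, norm_pow, norm_one]
      field_simp
      ring
    refine (norm_sub_le _ _).trans ?_
    linarith

/-- Let `q` be the component of `m` along the sign of `z`. Then `‖z - m‖ ^ 2 - (‖z‖ - q) ^ 2 = ‖m‖ ^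
2 - q ^ 2`, and dividing by the sum of the bases, which is at most `2 * (1 + ‖z‖)`, gives the
quadratic gain. Writing `2 * (‖m‖ ^ 2 - q ^ 2)` through `m ^ 2 * conj (signSq z)` separates `m` from
`z`, so the bound can be averaged over a sample. -/
lemma norm_sub_sub_norm_ge {z m : ℂ} (hz : z ≠ 0) (hm : ‖m‖ ≤ 1) :
    -(m * conj (complexSign z)).re
        + (‖m‖ ^ 2 - (m ^ 2 * conj (signSq z)).re) / (4 * (1 + ‖z‖)) ≤ ‖z - m‖ - ‖z‖ := by
  have hz' : 0 < ‖z‖ := norm_pos_iff.2 hz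
  have hcz : conj z ≠ 0 := by simpa using hz
  set s := complexSign z with hs
  have hss : s * conj s = 1 := by
    rw [hs, complexSign, map_div₀, Complex.conj_ofReal, div_mul_div_comm, Complex.mul_conj,
      Complex.normSq_eq_norm_sq]
    push_cast
    have : (‖z‖ : ℂ) ≠ 0 := by exact_mod_cast hz'.ne'
    field_simp
  have hzs : z = ‖z‖ * s := by
    have : (‖z‖ : ℂ) ≠ 0 := by exact_mod_cast hz'.ne'
    rw [hs, complexSign]; field_simp
  have hsq : signSq z = s ^ 2 := by
    have hcs : conj s ≠ 0 := fun h => by simp [h] at hss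
    have : (‖z‖ : ℂ) ≠ 0 := by exact_mod_cast hz'.ne'
    rw [signSq_of_ne hz]
    conv_lhs => rw [hzs]
    rw [map_mul, Complex.conj_ofReal, mul_div_mul_left _ _ this, div_eq_iff hcs]
    linear_combination -s * hss
  have hss' : s.re ^ 2 + s.im ^ 2 = 1 := by
    have := congrArg Complex.re hss
    simp at this
    linarith
  set q := (m * conj s).re with hq
  have hN : ‖m‖ ^ 2 - (m ^ 2 * conj (signSq z)).re = 2 * (‖m‖ ^ 2 - q ^ 2) := by
    have h1 : (m ^ 2 * conj (signSq z)) = (m * conj s) ^ 2 := by rw [hsq, map_pow]; ring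
    have h2 : ‖m‖ ^ 2 = (m * conj s).re ^ 2 + (m * conj s).im ^ 2 := by
      rw [← Complex.normSq_eq_norm_sq, Complex.normSq_apply]
      simp
      linear_combination -(m.re ^ 2 + m.im ^ 2) * hss'
    rw [h1, pow_two (m * conj s), Complex.mul_re, ← hq, h2]
    ring
  have hA : ‖z - m‖ ^ 2 = (‖z‖ - q) ^ 2 + (‖m‖ ^ 2 - q ^ 2) := by
    have h3 : ‖z - m‖ ^ 2 = ‖z‖ ^ 2 - 2 * (z * conj m).re + ‖m‖ ^ 2 := by
      simp only [← Complex.normSq_eq_norm_sq]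
      rw [Complex.normSq_sub]; ring
    have h4 : (z * conj m).re = ‖z‖ * q := by
      conv_lhs => rw [hzs]
      rw [mul_assoc, Complex.re_ofReal_mul, hq]
      simp
      left; ring
    rw [h3, h4]; ring
  have hN0 : 0 ≤ ‖m‖ ^ 2 - q ^ 2 := by
    have : q ^ 2 ≤ ‖m‖ ^ 2 := by
      have h5 : |q| ≤ ‖m‖ := by
        refine (Complex.abs_re_le_norm _).trans ?_
        have : ‖s‖ = 1 := by
          have : ‖s‖ ^ 2 = 1 := by
            rw [← Complex.normSq_eq_norm_sq, Complex.normSq_apply]; linarith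
          nlinarith [norm_nonneg s]
        simp [this]
      exact sq_le_sq' (by linarith [neg_abs_le q]) ((le_abs_self q).trans h5)
    linarith
  have hAB : ‖z‖ - q ≤ ‖z - m‖ := by
    exact (abs_le_of_sq_le_sq' (by linarith) (norm_nonneg _)).2
  have hA1 : ‖z - m‖ ≤ 1 + ‖z‖ := (norm_sub_le _ _).trans (by linarith)
  rw [hN]
  have : 2 * (‖m‖ ^ 2 - q ^ 2) / (4 * (1 + ‖z‖)) ≤ ‖z - m‖ - (‖z‖ - q) := by
    rw [div_le_iff₀ (by linarith)]
    nlinarith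
  linarith

/-- A minimizer of the sum of distances is controlled by the mean sign. -/
lemma norm_median_le {z : ℕ → ℂ} {n : ℕ} (hn : 0 < n) (hz : ∀ i, z i ≠ 0) {m : ℂ}
    (hm : ∀ m', ∑ i ∈ Finset.range n, ‖z i - m‖ ≤ ∑ i ∈ Finset.range n, ‖z i - m'‖)
    {l : ℝ} (hl : 0 < l)
    (hcurv : 4 * l ≤ empMean (fun w => (1 + ‖w‖)⁻¹) z n
      - ‖empMean (fun w => (1 + ‖w‖)⁻¹ • conj (signSq w)) z n‖)
    (hg : ‖empMean complexSign z n‖ < l) :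
    ‖m‖ ≤ l⁻¹ * ‖empMean complexSign z n‖ := by
  set g := empMean complexSign z n with hgdef
  set a := empMean (fun w => (1 + ‖w‖)⁻¹) z n with hadef
  set c := empMean (fun w => (1 + ‖w‖)⁻¹ • conj (signSq w)) z n with hcdef
  have hn' : (0 : ℝ) < n := by exact_mod_cast hn
  -- On the unit disc the centred criterion dominates a quadratic: the averaged curvature is at
  -- least `(a - ‖c‖) / 4 ≥ l`.
  have low : ∀ m' : ℂ, ‖m'‖ ≤ 1 → l * ‖m'‖ ^ 2 - ‖m'‖ * ‖g‖ ≤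
      (n : ℝ)⁻¹ * ∑ i ∈ Finset.range n, (‖z i - m'‖ - ‖z i‖) := by
    intro m' hm'
    have h1 : (n : ℝ)⁻¹ * ∑ i ∈ Finset.range n, (-(m' * conj (complexSign (z i))).re
        + (‖m'‖ ^ 2 - (m' ^ 2 * conj (signSq (z i))).re) / (4 * (1 + ‖z i‖))) ≤
        (n : ℝ)⁻¹ * ∑ i ∈ Finset.range n, (‖z i - m'‖ - ‖z i‖) := by
      gcongr with i
      exact norm_sub_sub_norm_ge (hz i) hm'
    refine le_trans ?_ h1
    have h2 : (n : ℝ)⁻¹ * ∑ i ∈ Finset.range n, (-(m' * conj (complexSign (z i))).re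
        + (‖m'‖ ^ 2 - (m' ^ 2 * conj (signSq (z i))).re) / (4 * (1 + ‖z i‖)))
        = -(m' * conj g).re + (‖m'‖ ^ 2 * a - (m' ^ 2 * c).re) / 4 := by
      rw [hgdef, hadef, hcdef]
      simp only [empMean, Complex.real_smul, map_mul, map_sum, Complex.conj_ofReal, smul_eq_mul]
      rw [show m' * (((n : ℝ)⁻¹ : ℝ) * ∑ x ∈ Finset.range n, conj (complexSign (z x)))
        = ((n : ℝ)⁻¹ : ℝ) * ∑ x ∈ Finset.range n, m' * conj (complexSign (z x)) by
          rw [Finset.mul_sum, Finset.mul_sum, Finset.mul_sum]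
          exact Finset.sum_congr rfl fun _ _ => by ring]
      rw [show m' ^ 2 * ((((n : ℝ)⁻¹ : ℝ) : ℂ) * ∑ x ∈ Finset.range n,
          (((1 + ‖z x‖)⁻¹ : ℝ) : ℂ) * conj (signSq (z x)))
        = ((n : ℝ)⁻¹ : ℝ) * ∑ x ∈ Finset.range n,
          (((1 + ‖z x‖)⁻¹ : ℝ) : ℂ) * (m' ^ 2 * conj (signSq (z x))) by
          rw [Finset.mul_sum, Finset.mul_sum, Finset.mul_sum]
          exact Finset.sum_congr rfl fun _ _ => by ring]
      rw [Complex.re_ofReal_mul, Complex.re_ofReal_mul, Complex.re_sum, Complex.re_sum]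
      simp only [Complex.re_ofReal_mul]
      rw [Finset.sum_add_distrib, mul_add, Finset.sum_neg_distrib, mul_neg]
      congr 1
      rw [mul_left_comm, ← mul_sub, mul_div_assoc]
      congr 1
      rw [Finset.mul_sum, ← Finset.sum_sub_distrib, Finset.sum_div]
      refine Finset.sum_congr rfl fun i _ => ?_
      have : 1 + ‖z i‖ ≠ 0 := by positivity
      field_simp
    rw [h2]
    have h3 : (m' * conj g).re ≤ ‖m'‖ * ‖g‖ := by
      refine (Complex.re_le_norm _).trans ?_
      simp
    have h4 : (m' ^ 2 * c).re ≤ ‖m'‖ ^ 2 * ‖c‖ := by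
      refine (Complex.re_le_norm _).trans ?_
      simp
    nlinarith [sq_nonneg ‖m'‖]
  -- By convexity the criterion on the segment from `0` to `m` is at most its value at `0`, so the
  -- quadratic bound can be tested at `t * m` even before `m` is known to lie in the unit disc.
  have conv : ∀ t : ℝ, 0 ≤ t → t ≤ 1 → t * ‖m‖ ≤ 1 →
      l * (t * ‖m‖) ^ 2 ≤ (t * ‖m‖) * ‖g‖ := by
    intro t ht0 ht1 htm
    have hnorm : ‖(t : ℂ) * m‖ = t * ‖m‖ := by simp [abs_of_nonneg ht0]
    have h1 := low (t * m) (by rwa [hnorm])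
    have h2 : ∑ i ∈ Finset.range n, (‖z i - t * m‖ - ‖z i‖) ≤ 0 := by
      have h3 : ∑ i ∈ Finset.range n, (‖z i - t * m‖ - ‖z i‖)
          ≤ ∑ i ∈ Finset.range n, t * (‖z i - m‖ - ‖z i‖) := by
        refine Finset.sum_le_sum fun i _ => ?_
        have : z i - t * m = ((1 - t : ℝ) : ℂ) * z i + (t : ℂ) * (z i - m) := by push_cast; ring
        have h4 : ‖z i - t * m‖ ≤ (1 - t) * ‖z i‖ + t * ‖z i - m‖ := by
          rw [this]
          refine (norm_add_le _ _).trans ?_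
          simp only [norm_mul, Complex.norm_real, Real.norm_eq_abs, abs_of_nonneg ht0,
            abs_of_nonneg (sub_nonneg.2 ht1), le_refl]
        linarith
      refine h3.trans ?_
      rw [← Finset.mul_sum, Finset.sum_sub_distrib]
      have := hm 0
      simp only [sub_zero] at this
      exact mul_nonpos_of_nonneg_of_nonpos ht0 (by linarith)
    have h5 : (n : ℝ)⁻¹ * ∑ i ∈ Finset.range n, (‖z i - t * m‖ - ‖z i‖) ≤ 0 :=
      mul_nonpos_of_nonneg_of_nonpos (by positivity) h2
    rw [hnorm] at h1
    linarith
  -- If `‖m‖ ≥ 1`, rescaling `m` to unit length would give `l ≤ ‖g‖`.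
  have hm1 : ‖m‖ < 1 := by
    by_contra! h
    have h0 : 0 < ‖m‖ := by linarith
    have := conv ‖m‖⁻¹ (by positivity) (inv_le_one_of_one_le₀ h) (by rw [inv_mul_cancel₀ h0.ne'])
    rw [inv_mul_cancel₀ h0.ne'] at this
    linarith
  have h := conv 1 zero_le_one le_rfl (by linarith)
  rw [one_mul] at h
  rw [inv_mul_eq_div, le_div_iff₀ hl]
  rcases (norm_nonneg m).eq_or_lt with h0 | h0
  · rw [← h0]; simp
  · nlinarith

/-- Medians of a sample with well-behaved averages are eventually of the order of the mean sign. -/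
lemma eventually_norm_median_le {z : ℕ → ℂ} (hz : ∀ i, z i ≠ 0) {m : ℕ → ℂ}
    (hm : ∀ n m', ∑ i ∈ Finset.range n, ‖z i - m n‖ ≤ ∑ i ∈ Finset.range n, ‖z i - m'‖)
    {a : ℝ} {c : ℂ} (hac : ‖c‖ < a)
    (hg : Tendsto (empMean complexSign z) atTop (𝓝 0))
    (ha : Tendsto (empMean (fun w => (1 + ‖w‖)⁻¹) z) atTop (𝓝 a))
    (hc : Tendsto (empMean (fun w => (1 + ‖w‖)⁻¹ • conj (signSq w)) z) atTop (𝓝 c)) :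
    ∃ K : ℝ, 0 < K ∧ ∀ᶠ n in atTop, ‖m n‖ ≤ K * ‖empMean complexSign z n‖ := by
  -- With this `l`, `4 * l` is half the limiting gap, so the sample gap eventually exceeds it.
  have hl : 0 < (a - ‖c‖) / 8 := by linarith
  refine ⟨((a - ‖c‖) / 8)⁻¹, inv_pos.2 hl, ?_⟩
  have h1 := (ha.sub hc.norm).eventually_const_le (u := 4 * ((a - ‖c‖) / 8)) (by linarith)
  have h2 := hg.norm.eventually_lt_const (u := (a - ‖c‖) / 8) (by simpa using hl)
  filter_upwards [h1, h2, eventually_gt_atTop 0] with n hn1 hn2 hn0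
  exact norm_median_le hn0 hz (hm n) hl hn1 hn2

/-- The first-order coefficients are kept as averages inside the norm: their kernels are odd, so
they vanish in the limit, which termwise norms would not. -/
lemma norm_empMean_signSq_sub_le {z : ℕ → ℂ} (hz : ∀ i, z i ≠ 0) {m : ℂ} {η : ℝ} (hm : ‖m‖ ≤ η)
    (n : ℕ) :
    ‖empMean (fun w => signSq (w - m)) z n - empMean signSq z n‖ ≤
      ‖m‖ * (‖empMean (fun w => w / conj w ^ 2) z n‖ + ‖empMean (fun w => 1 / conj w) z n‖
        + 6 * empMean (remKernel η) z n) := by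
  have hid : empMean (fun w => signSq (w - m)) z n - empMean signSq z n =
      (conj m * empMean (fun w => w / conj w ^ 2) z n - m * empMean (fun w => 1 / conj w) z n)
      + (n : ℝ)⁻¹ • ∑ i ∈ Finset.range n, (signSq (z i - m) - signSq (z i) -
        (conj m * (z i / conj (z i) ^ 2) - m * (1 / conj (z i)))) := by
    simp only [empMean, Finset.sum_sub_distrib, ← Finset.mul_sum, smul_sub, Complex.real_smul]
    ring
  have hrem : ‖(n : ℝ)⁻¹ • ∑ i ∈ Finset.range n, (signSq (z i - m) - signSq (z i) -
        (conj m * (z i / conj (z i) ^ 2) - m * (1 / conj (z i))))‖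
      ≤ 6 * ‖m‖ * empMean (remKernel η) z n := by
    rw [norm_smul, Real.norm_of_nonneg (by positivity), empMean, smul_eq_mul, mul_left_comm]
    refine mul_le_mul_of_nonneg_left ?_ (by positivity)
    rw [Finset.mul_sum]
    exact norm_sum_le_of_le _ fun i _ => norm_signSq_sub_sub_le (hz i) hm
  rw [hid]
  refine (norm_add_le _ _).trans ((add_le_add (norm_sub_le _ _) hrem).trans (le_of_eq ?_))
  rw [norm_mul, norm_mul, RCLike.norm_conj]
  ring

/-- Replacing the true centre by the median changes the mean squared sign by less than the order of
the mean sign. -/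
lemma eventually_norm_empMean_signSq_sub_le {z : ℕ → ℂ} (hz : ∀ i, z i ≠ 0) {m : ℕ → ℂ} {K : ℝ}
    (hK : 0 < K) (hm : ∀ᶠ n in atTop, ‖m n‖ ≤ K * ‖empMean complexSign z n‖)
    (hg : Tendsto (empMean complexSign z) atTop (𝓝 0))
    (hu : Tendsto (empMean (fun w => w / conj w ^ 2) z) atTop (𝓝 0))
    (hv : Tendsto (empMean (fun w => 1 / conj w) z) atTop (𝓝 0))
    {e : ℕ → ℝ} (he : ∀ k : ℕ, Tendsto (empMean (remKernel (1 / ((k : ℝ) + 1))) z) atTop (𝓝 (e k)))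
    (he0 : Tendsto e atTop (𝓝 0)) {δ : ℝ} (hδ : 0 < δ) :
    ∀ᶠ n in atTop, ‖empMean (fun w => signSq (w - m n)) z n - empMean signSq z n‖
      ≤ δ * ‖empMean complexSign z n‖ := by
  -- The radius is fixed first, making the limiting remainder small; only then does `n` grow, until
  -- the median lies within that radius.
  obtain ⟨k, hk⟩ := (he0.eventually_lt_const (u := δ / K / 6) (by positivity)).exists
  have hη : 0 < 1 / ((k : ℝ) + 1) := by positivity
  have h1 : ∀ᶠ n in atTop, K * ‖empMean complexSign z n‖ ≤ 1 / ((k : ℝ) + 1) :=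
    (hg.norm.const_mul K).eventually_le_const (by simpa using hη)
  have h2 : ∀ᶠ n in atTop, ‖empMean (fun w => w / conj w ^ 2) z n‖
      + ‖empMean (fun w => 1 / conj w) z n‖
        + 6 * empMean (remKernel (1 / ((k : ℝ) + 1))) z n ≤ δ / K :=
    ((hu.norm.add hv.norm).add ((he k).const_mul 6)).eventually_le_const (by
      simp only [norm_zero]; linarith)
  filter_upwards [hm, h1, h2] with n hn hn1 hn2
  refine (norm_empMean_signSq_sub_le hz (hn.trans hn1) n).trans ?_
  calc _ ≤ ‖m n‖ * (δ / K) := by gcongr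
    _ ≤ K * ‖empMean complexSign z n‖ * (δ / K) := by gcongr
    _ = δ * ‖empMean complexSign z n‖ := by field_simp

/-- Pathwise delta method for an estimator `y` close to `x`, up to errors of smaller order than
`g + ‖x - ζ‖`. -/
lemma eventually_abs_delta_le {x y : ℕ → ℂ} {g : ℕ → ℝ} {ζ : ℂ}
    (hg : Tendsto g atTop (𝓝 0)) (hx : Tendsto x atTop (𝓝 ζ))
    (hxy : ∀ δ : ℝ, 0 < δ → ∀ᶠ n in atTop, ‖y n - x n‖ ≤ δ * g n)
    {Φ : ℂ → ℝ} {L : ℂ →L[ℝ] ℝ} (hΦ : HasFDerivAt Φ L ζ) :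
    Tendsto y atTop (𝓝 ζ) ∧ ∀ δ : ℝ, 0 < δ → ∀ᶠ n in atTop,
      |Φ (y n) - Φ ζ - L (x n - ζ)| ≤ δ * (g n + ‖x n - ζ‖) := by
  have hy : Tendsto y atTop (𝓝 ζ) := by
    have h0 : Tendsto (fun n => y n - x n) atTop (𝓝 0) := by
      refine squeeze_zero_norm' (hxy 1 one_pos) (by simpa using hg)
    simpa using h0.add hx
  refine ⟨hy, fun δ hδ => ?_⟩
  have hδ' : 0 < δ / 2 := by positivity
  have hLp : 0 < ‖L‖ + 1 := by positivity
  have h1 := hy.eventually (hΦ.isLittleO.def hδ')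
  filter_upwards [h1, hxy 1 one_pos, hxy (δ / 2 / (‖L‖ + 1)) (by positivity)] with n hn1 hn2 hn3
  -- The differentiability error is taken at `y n`, and `L` absorbs the shift from `x n`; each
  -- receives half of `δ`. The `‖L‖ + 1` covers `L = 0`.
  have e : Φ (y n) - Φ ζ - L (x n - ζ) = (Φ (y n) - Φ ζ - L (y n - ζ)) + L (y n - x n) := by
    simp only [map_sub]; ring
  have h4 : ‖y n - ζ‖ ≤ g n + ‖x n - ζ‖ := by
    have : y n - ζ = (y n - x n) + (x n - ζ) := by ring
    rw [this]
    exact (norm_add_le _ _).trans (by linarith)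
  have h5 : ‖L (y n - x n)‖ ≤ δ / 2 * g n := by
    calc ‖L (y n - x n)‖ ≤ ‖L‖ * ‖y n - x n‖ := L.le_opNorm _
      _ ≤ (‖L‖ + 1) * (δ / 2 / (‖L‖ + 1) * g n) := by gcongr; linarith
      _ = δ / 2 * g n := by field_simp
  rw [e, ← Real.norm_eq_abs]
  refine (norm_add_le _ _).trans ?_
  have h6 : δ / 2 * ‖y n - ζ‖ ≤ δ / 2 * (g n + ‖x n - ζ‖) := by gcongr
  have h7 : 0 ≤ δ / 2 * ‖x n - ζ‖ := by positivity
  linarith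

/-! ### Symmetric laws with prescribed moments of the squared sign. -/

lemma measurable_signSq : Measurable signSq :=
  Measurable.ite (measurableSet_singleton 0) measurable_const
    (measurable_id.div Complex.continuous_conj.measurable)

lemma measurable_complexSign : Measurable complexSign := by
  unfold complexSign; fun_prop

lemma measurable_conj_complex : Measurable (fun w : ℂ => conj w) :=
  Complex.continuous_conj.measurable

lemma norm_complexSign_le (w : ℂ) : ‖complexSign w‖ ≤ 1 := by
  rw [complexSign, norm_div, Complex.norm_real, norm_norm]
  exact div_self_le_one _

/-- The properties of a law on the plane on which the asymptotics of the spatial sign covariance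
matrix depend: it is symmetric, puts no mass on the origin, has a finite inverse moment, and its
squared sign has the first two moments `ζ` and `ζ ^ 2`, as for a wrapped Cauchy distribution. -/
structure HasSignMean (ν : Measure ℂ) (ζ : ℂ) : Prop where
  isProbabilityMeasure : IsProbabilityMeasure ν
  map_neg : ν.map (fun z => -z) = ν
  ae_ne_zero : ∀ᵐ z ∂ν, z ≠ 0
  integrable_inv : Integrable (fun z : ℂ => ‖z‖⁻¹) ν
  integral_signSq : ∫ z, signSq z ∂ν = ζ
  integral_signSq_sq : ∫ z, signSq z ^ 2 ∂ν = ζ ^ 2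
  norm_lt_one : ‖ζ‖ < 1

section Law

variable {ν : Measure ℂ} {ζ : ℂ}

lemma integrable_of_norm_le_one {E : Type*} [NormedAddCommGroup E] [IsFiniteMeasure ν]
    {f : ℂ → E} (hf : AEStronglyMeasurable f ν) (h : ∀ z, ‖f z‖ ≤ 1) : Integrable f ν :=
  Integrable.of_bound hf 1 (.of_forall h)

lemma HasSignMean.integral_eq_zero_of_odd (h : HasSignMean ν ζ) {f : ℂ → ℂ}
    (hf : ∀ z, f (-z) = -f z) : ∫ z, f z ∂ν = 0 := by
  have h1 : ∫ z, f z ∂ν = ∫ z, f (-z) ∂ν := by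
    conv_lhs => rw [← h.map_neg]
    exact integral_map_equiv (MeasurableEquiv.neg ℂ) f
  simp only [hf, integral_neg] at h1
  exact self_eq_neg.1 h1

/-- Equality in the triangle inequality would force the squared sign to be almost surely constant,
that is, the law to live on a line. Its mean `ζ` would then have norm `1`. -/
lemma HasSignMean.curvature_pos (h : HasSignMean ν ζ) :
    ‖∫ z, (1 + ‖z‖)⁻¹ • conj (signSq z) ∂ν‖ < ∫ z, (1 + ‖z‖)⁻¹ ∂ν := by
  have := h.isProbabilityMeasure
  have hcm : Measurable (fun z => conj (signSq z)) := measurable_conj_complex.comp measurable_signSq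
  have hb : ∀ z : ℂ, (1 + ‖z‖)⁻¹ ≤ 1 := fun z =>
    inv_le_one_of_one_le₀ (by linarith [norm_nonneg z])
  have hb0 : ∀ z : ℂ, 0 < (1 + ‖z‖)⁻¹ := fun z => by positivity
  have hbm : Measurable fun z : ℂ => (1 + ‖z‖)⁻¹ := by fun_prop
  have ia : Integrable (fun z : ℂ => (1 + ‖z‖)⁻¹) ν :=
    integrable_of_norm_le_one hbm.aestronglyMeasurable
      fun z => by rw [Real.norm_of_nonneg (hb0 z).le]; exact hb z
  have ic : Integrable (fun z : ℂ => (1 + ‖z‖)⁻¹ • conj (signSq z)) ν :=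
    integrable_of_norm_le_one (hbm.smul hcm).aestronglyMeasurable
      fun z => by
        rw [norm_smul, RCLike.norm_conj, norm_signSq, Real.norm_of_nonneg (hb0 z).le]
        simpa using hb z
  have is : Integrable (fun z : ℂ => conj (signSq z)) ν :=
    integrable_of_norm_le_one hcm.aestronglyMeasurable
      fun z => by rw [RCLike.norm_conj, norm_signSq]
  set c := ∫ z, (1 + ‖z‖)⁻¹ • conj (signSq z) ∂ν with hc
  obtain ⟨κ, hκ, hκc⟩ : ∃ κ : ℂ, ‖κ‖ = 1 ∧ κ * c = ‖c‖ := by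
    rcases eq_or_ne c 0 with h0 | h0
    · exact ⟨1, by simp, by simp [h0]⟩
    · have : (‖c‖ : ℂ) ≠ 0 := by simpa using h0
      refine ⟨conj c / ‖c‖, by simp [h0], ?_⟩
      rw [div_mul_eq_mul_div, mul_comm, Complex.mul_conj, Complex.normSq_eq_norm_sq]
      push_cast
      field_simp
  have hre : ‖c‖ = ∫ z, (1 + ‖z‖)⁻¹ * (κ * conj (signSq z)).re ∂ν := by
    have h1 : ‖c‖ = (κ * c).re := by rw [hκc]; simp
    rw [h1, hc, ← integral_const_mul, ← RCLike.re_eq_complex_re, ← integral_re (ic.const_mul κ)]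
    refine integral_congr_ae (.of_forall fun z => ?_)
    simp only [RCLike.re_eq_complex_re, Complex.real_smul]
    rw [mul_left_comm, Complex.re_ofReal_mul]
  have ib : Integrable (fun z => (1 + ‖z‖)⁻¹ * (κ * conj (signSq z)).re) ν := by
    refine ((ic.const_mul κ).re).congr (.of_forall fun z => ?_)
    simp only [RCLike.re_eq_complex_re, Complex.real_smul]
    rw [mul_left_comm, Complex.re_ofReal_mul]
  have hle : ∀ z, (κ * conj (signSq z)).re ≤ 1 := fun z => by
    refine (Complex.re_le_norm _).trans ?_
    rw [norm_mul, RCLike.norm_conj, norm_signSq, hκ, one_mul]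
  by_contra! hcon
  have hint : ∫ z, (1 + ‖z‖)⁻¹ * (1 - (κ * conj (signSq z)).re) ∂ν = 0 := by
    have h0 : 0 ≤ ∫ z, (1 + ‖z‖)⁻¹ * (1 - (κ * conj (signSq z)).re) ∂ν :=
      integral_nonneg fun z => mul_nonneg (hb0 z).le (by linarith [hle z])
    have h1 : ∫ z, (1 + ‖z‖)⁻¹ * (1 - (κ * conj (signSq z)).re) ∂ν
        = ∫ z, (1 + ‖z‖)⁻¹ ∂ν - ‖c‖ := by
      rw [hre, ← integral_sub ia ib]
      exact integral_congr_ae (.of_forall fun z => by ring)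
    linarith
  rw [integral_eq_zero_iff_of_nonneg
    (fun z => mul_nonneg (hb0 z).le (by linarith [hle z]))
    ((ia.sub ib).congr (.of_forall fun z => by simp; ring))] at hint
  have hone : ∫ z, (κ * conj (signSq z)).re ∂ν = 1 := by
    rw [integral_congr_ae (g := fun _ => (1 : ℝ))]
    · simp
    · filter_upwards [hint] with z hz
      have := (mul_eq_zero.1 hz).resolve_left (hb0 z).ne'
      linarith
  have hval : ∫ z, (κ * conj (signSq z)).re ∂ν = (κ * conj ζ).re := by
    rw [← h.integral_signSq, ← integral_conj, ← integral_const_mul, ← RCLike.re_eq_complex_re,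
      ← integral_re (is.const_mul κ)]
  have : (κ * conj ζ).re ≤ ‖ζ‖ := by
    refine (Complex.re_le_norm _).trans ?_
    rw [norm_mul, RCLike.norm_conj, hκ, one_mul]
  linarith [h.norm_lt_one]

lemma remKernel_nonneg {η : ℝ} (hη : 0 ≤ η) (z : ℂ) : 0 ≤ remKernel η z := by
  unfold remKernel; positivity

lemma remKernel_le (η : ℝ) (z : ℂ) : remKernel η z ≤ ‖z‖⁻¹ :=
  mul_le_of_le_one_right (by positivity) (min_le_left _ _)

lemma measurable_remKernel (η : ℝ) : Measurable (remKernel η) := by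
  unfold remKernel; fun_prop

lemma HasSignMean.integrable_remKernel (h : HasSignMean ν ζ) {η : ℝ} (hη : 0 ≤ η) :
    Integrable (remKernel η) ν :=
  h.integrable_inv.mono' (measurable_remKernel η).aestronglyMeasurable
    (.of_forall fun z => by
      rw [Real.norm_of_nonneg (remKernel_nonneg hη z)]; exact remKernel_le η z)

/-- Dominated convergence with majorant `‖z‖⁻¹`; this is where the finite inverse moment makes the
quadratic remainder negligible. -/
lemma HasSignMean.tendsto_integral_remKernel (h : HasSignMean ν ζ) :
    Tendsto (fun k : ℕ => ∫ z, remKernel (1 / ((k : ℝ) + 1)) z ∂ν) atTop (𝓝 0) := by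
  have h0 : ∫ _ : ℂ, (0 : ℝ) ∂ν = 0 := by simp
  rw [← h0]
  refine tendsto_integral_of_dominated_convergence (fun z => ‖z‖⁻¹)
    (fun k => (measurable_remKernel _).aestronglyMeasurable) h.integrable_inv
    (fun k => .of_forall fun z => ?_) (.of_forall fun z => ?_)
  · rw [Real.norm_of_nonneg (remKernel_nonneg (by positivity) z)]; exact remKernel_le _ z
  · have h1 := tendsto_one_div_add_atTop_nhds_zero_nat (𝕜 := ℝ)
    have h2 : Tendsto (fun k : ℕ => ‖z‖⁻¹ * min 1 (2 * (1 / ((k : ℝ) + 1)) / ‖z‖)) atTop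
        (𝓝 (‖z‖⁻¹ * min 1 (2 * 0 / ‖z‖))) :=
      (tendsto_const_nhds.min ((h1.const_mul 2).div_const _)).const_mul _
    simpa [remKernel] using h2

/-- The variance of a linear functional of the squared sign. -/
lemma HasSignMean.variance_comp_signSq (h : HasSignMean ν ζ) (L : ℂ →L[ℝ] ℝ) :
    Var[fun z => L (signSq z); ν]
      = (L 1 ^ 2 + L Complex.I ^ 2) * (1 - ‖ζ‖ ^ 2) / 2 := by
  have := h.isProbabilityMeasure
  have hL : ∀ w : ℂ, L w = w.re * L 1 + w.im * L Complex.I := fun w => by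
    conv_lhs => rw [← Complex.re_add_im w]
    rw [map_add, show (w.re : ℂ) = w.re • (1 : ℂ) by simp,
      show (w.im : ℂ) * Complex.I = w.im • Complex.I by simp, map_smul, map_smul]
    simp
  -- Chosen so that `L w = (κ * w).re`. Squaring splits `L w ^ 2` into a part in `w ^ 2` and a part
  -- in `‖w‖ ^ 2`; since the second moment is `ζ ^ 2`, the first part cancels in the variance.
  set κ : ℂ := ⟨L 1, -L Complex.I⟩ with hκ
  have hsq : ∀ w : ℂ, L w ^ 2 = ((κ ^ 2 * w ^ 2).re + (L 1 ^ 2 + L Complex.I ^ 2) * ‖w‖ ^ 2) / 2 :=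
    fun w => by
      rw [hL, ← Complex.normSq_eq_norm_sq, Complex.normSq_apply]
      simp [hκ, pow_two]
      ring
  have i1 : Integrable signSq ν :=
    integrable_of_norm_le_one measurable_signSq.aestronglyMeasurable fun z => (norm_signSq z).le
  have i2 : Integrable (fun z => signSq z ^ 2) ν :=
    integrable_of_norm_le_one (measurable_signSq.pow_const 2).aestronglyMeasurable
      fun z => by rw [norm_pow, norm_signSq, one_pow]
  have hm : MemLp (fun z => L (signSq z)) 2 ν :=
    MemLp.of_bound (L.measurable.comp measurable_signSq).aestronglyMeasurable ‖L‖
      (.of_forall fun z => by simpa [norm_signSq] using L.le_opNorm (signSq z))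
  rw [variance_eq_sub hm, L.integral_comp_comm i1, h.integral_signSq]
  have hI : ∫ z, ((fun z => L (signSq z)) ^ 2) z ∂ν
      = ((κ ^ 2 * ζ ^ 2).re + (L 1 ^ 2 + L Complex.I ^ 2)) / 2 := by
    have h1 : ∀ z, ((fun z => L (signSq z)) ^ 2) z
        = ((κ ^ 2 * signSq z ^ 2).re + (L 1 ^ 2 + L Complex.I ^ 2)) / 2 := fun z => by
      rw [Pi.pow_apply, hsq, norm_signSq]; ring
    simp_rw [h1]
    have i3 : Integrable (fun z => (κ ^ 2 * signSq z ^ 2).re) ν := (i2.const_mul _).re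
    rw [integral_div, integral_add i3 (integrable_const _), integral_const]
    have h2 : ∫ z, (κ ^ 2 * signSq z ^ 2).re ∂ν = (κ ^ 2 * ζ ^ 2).re := by
      rw [← h.integral_signSq_sq, ← integral_const_mul, ← RCLike.re_eq_complex_re,
        ← integral_re (i2.const_mul _)]
    rw [h2]
    simp
  have := hsq ζ
  rw [hI, this]
  ring

end Law

/-! ### Boundedness in probability and averages of i.i.d. variables. -/

section Sequences

variable {Ω : Type*} [MeasurableSpace Ω] {P : Measure Ω}

/-- The sequence `B` of random variables is bounded above in probability. -/
def BoundedInProb (P : Measure Ω) (B : ℕ → Ω → ℝ) : Prop :=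
  ∀ ε : ℝ≥0∞, 0 < ε → ∃ M : ℝ, 0 < M ∧ ∀ n, P {ω | M ≤ B n ω} ≤ ε

lemma BoundedInProb.add {B B' : ℕ → Ω → ℝ} (h : BoundedInProb P B) (h' : BoundedInProb P B') :
    BoundedInProb P (fun n ω => B n ω + B' n ω) := by
  intro ε hε
  obtain ⟨M, hM, h1⟩ := h (ε / 2) (ENNReal.half_pos hε.ne')
  obtain ⟨M', hM', h2⟩ := h' (ε / 2) (ENNReal.half_pos hε.ne')
  refine ⟨M + M', by positivity, fun n => ?_⟩
  have hsub : {ω | M + M' ≤ B n ω + B' n ω} ⊆ {ω | M ≤ B n ω} ∪ {ω | M' ≤ B' n ω} := by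
    intro ω hω
    simp only [Set.mem_ofPred_eq, Set.mem_union] at hω ⊢
    by_contra! hcon
    linarith
  calc P {ω | M + M' ≤ B n ω + B' n ω} ≤ P {ω | M ≤ B n ω} + P {ω | M' ≤ B' n ω} :=
        (measure_mono hsub).trans (measure_union_le _ _)
    _ ≤ ε / 2 + ε / 2 := add_le_add (h1 n) (h2 n)
    _ = ε := ENNReal.add_halves ε

lemma BoundedInProb.mono {B B' : ℕ → Ω → ℝ} (h : BoundedInProb P B)
    (hle : ∀ n ω, B' n ω ≤ B n ω) : BoundedInProb P B' := by
  intro ε hε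
  obtain ⟨M, hM, h1⟩ := h ε hε
  exact ⟨M, hM, fun n => (measure_mono fun ω hω => le_trans hω (hle n ω)).trans (h1 n)⟩

/-- A sequence that is almost surely of smaller order than a sequence bounded in probability tends
to zero in probability. -/
lemma tendstoInMeasure_zero_of_eventually_le [IsFiniteMeasure P] {D B : ℕ → Ω → ℝ}
    (hD : ∀ n, AEMeasurable (D n) P) (hB : ∀ n, AEMeasurable (B n) P) (hBb : BoundedInProb P B)
    (h : ∀ᵐ ω ∂P, ∀ δ : ℝ, 0 < δ → ∀ᶠ n in atTop, |D n ω| ≤ δ * B n ω) :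
    TendstoInMeasure P D atTop 0 := by
  rw [tendstoInMeasure_iff_norm]
  intro ε hε
  rw [ENNReal.tendsto_nhds_zero]
  intro r hr
  obtain ⟨M, hM, hMn⟩ := hBb (r / 2) (ENNReal.half_pos hr.ne')
  set δ := ε / (2 * M) with hδ
  have hδ0 : 0 < δ := by positivity
  have hA : ∀ n, NullMeasurableSet {ω | δ * B n ω < |D n ω|} P := fun n =>
    nullMeasurableSet_lt ((hB n).const_mul δ) (hD n).abs
  -- The indicators of the failure events tend to `0` almost surely, hence in measure; this converts
  -- the pathwise order relation into a probability bound uniform in `ω`.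
  have hQ : TendstoInMeasure P (fun n => Set.indicator {ω | δ * B n ω < |D n ω|} (fun _ => (1 : ℝ)))
      atTop 0 := by
    refine tendstoInMeasure_of_tendsto_ae
      (fun n => aestronglyMeasurable_const.indicator₀ (hA n)) ?_
    filter_upwards [h] with ω hω
    refine tendsto_const_nhds.congr' ?_
    filter_upwards [hω δ hδ0] with n hn
    simp [hn]
  rw [tendstoInMeasure_iff_norm] at hQ
  have hQ1 := (ENNReal.tendsto_nhds_zero.1 (hQ 1 one_pos)) (r / 2) (ENNReal.half_pos hr.ne')
  filter_upwards [hQ1] with n hn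
  have hsub : {ω | ε ≤ ‖D n ω - (0 : Ω → ℝ) ω‖} ⊆ {ω | M ≤ B n ω} ∪
      {ω | 1 ≤ ‖Set.indicator {ω | δ * B n ω < |D n ω|} (fun _ => (1 : ℝ)) ω - (0 : Ω → ℝ) ω‖} := by
    intro ω hω
    by_cases hMB : M ≤ B n ω
    · exact Or.inl hMB
    · right
      have h1 : δ * B n ω < |D n ω| := by
        simp only [Pi.zero_apply, sub_zero, Real.norm_eq_abs, Set.mem_ofPred_eq] at hω
        have : δ * B n ω ≤ δ * M := by gcongr; linarith
        have h2 : δ * M = ε / 2 := by rw [hδ]; field_simp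
        linarith
      simp [h1]
  calc _ ≤ _ := (measure_mono hsub).trans (measure_union_le _ _)
    _ ≤ r / 2 + r / 2 := add_le_add (hMn n) hn
    _ = r := ENNReal.add_halves r

variable {ν : Measure ℂ} {Z : ℕ → Ω → ℂ}

lemma identDistrib_comp_of_law {E : Type*} [MeasurableSpace E] (hZm : ∀ i, AEMeasurable (Z i) P)
    (hlaw : ∀ i, P.map (Z i) = ν) {f : ℂ → E} (hf : Measurable f) (i j : ℕ) :
    IdentDistrib (fun ω => f (Z i ω)) (fun ω => f (Z j ω)) P P :=
  IdentDistrib.comp ⟨hZm i, hZm j, by rw [hlaw, hlaw]⟩ hf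

lemma ae_tendsto_empMean [IsProbabilityMeasure P] {E : Type*} [NormedAddCommGroup E]
    [NormedSpace ℝ E] [CompleteSpace E]
    [MeasurableSpace E] [BorelSpace E] [SecondCountableTopology E]
    (hZm : ∀ i, AEMeasurable (Z i) P) (hind : iIndepFun Z P) (hlaw : ∀ i, P.map (Z i) = ν)
    {f : ℂ → E} (hf : Measurable f) (hint : Integrable f ν) :
    ∀ᵐ ω ∂P, Tendsto (empMean f (fun i => Z i ω)) atTop (𝓝 (∫ z, f z ∂ν)) := by
  have h1 : Integrable (fun ω => f (Z 0 ω)) P := by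
    rw [← hlaw 0] at hint
    exact hint.comp_aemeasurable (hZm 0)
  have h2 : ∫ ω, f (Z 0 ω) ∂P = ∫ z, f z ∂ν := by
    rw [← hlaw 0, integral_map (hZm 0) hf.aestronglyMeasurable]
  rw [← h2]
  refine strong_law_ae (fun i ω => f (Z i ω)) h1 ?_
    (fun i => identDistrib_comp_of_law hZm hlaw hf i 0)
  intro i j hij
  exact (hind.indepFun hij).comp hf hf

/-- Chebyshev's inequality, as the variance of the sum grows linearly in `n`. -/
lemma boundedInProb_real [IsProbabilityMeasure P]
    (hZm : ∀ i, AEMeasurable (Z i) P) (hind : iIndepFun Z P) (hlaw : ∀ i, P.map (Z i) = ν)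
    {f : ℂ → ℝ} (hf : Measurable f) {C : ℝ} (hb : ∀ z, |f z| ≤ C) :
    BoundedInProb P (fun n ω => √(n : ℝ) * |empMean f (fun i => Z i ω) n - ∫ z, f z ∂ν|) := by
  have hC : 0 ≤ C := (abs_nonneg _).trans (hb 0)
  have hmem : ∀ i, MemLp (fun ω => f (Z i ω)) 2 P := fun i =>
    MemLp.of_bound (hf.comp_aemeasurable (hZm i)).aestronglyMeasurable C
      (.of_forall fun ω => hb _)
  have hE : ∀ i, ∫ ω, f (Z i ω) ∂P = ∫ z, f z ∂ν := fun i => by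
    rw [← hlaw i, integral_map (hZm i) hf.aestronglyMeasurable]
  set v := Var[fun ω => f (Z 0 ω); P] with hv
  have hvar : ∀ n : ℕ, Var[∑ i ∈ Finset.range n, fun ω => f (Z i ω); P] = n * v := fun n => by
    rw [IndepFun.variance_sum (fun i _ => hmem i)
      (fun i _ j _ hij => (hind.indepFun hij).comp hf hf)]
    rw [Finset.sum_congr rfl fun i _ => (identDistrib_comp_of_law hZm hlaw hf i 0).variance_eq]
    simp [hv]
  have hv0 : 0 ≤ v := variance_nonneg _ _
  intro ε hε
  obtain ⟨r, hr0, hrε⟩ : ∃ r : ℝ, 0 < r ∧ ENNReal.ofReal r ≤ ε := by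
    rcases eq_or_ne ε ∞ with h | h
    · exact ⟨1, one_pos, by simp [h]⟩
    · exact ⟨ε.toReal, ENNReal.toReal_pos hε.ne' h, by rw [ENNReal.ofReal_toReal h]⟩
  -- Makes the Chebyshev bound `v / M ^ 2` at most `r`; the `+ 1` keeps `M` positive when `v = 0`.
  set M := √((v + 1) / r) with hM
  have hM0 : 0 < M := by positivity
  have hM2 : M ^ 2 = (v + 1) / r := Real.sq_sqrt (by positivity)
  refine ⟨M, hM0, fun n => ?_⟩
  rcases Nat.eq_zero_or_pos n with rfl | hn
  · simp [hM0.not_ge]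
  have hn' : (0 : ℝ) < n := by exact_mod_cast hn
  have hs : 0 < √(n : ℝ) := Real.sqrt_pos.2 hn'
  have hch := meas_ge_le_variance_div_sq
    (memLp_finsetSum' (Finset.range n) fun i _ => hmem i) (c := M * √n) (by positivity)
  have hmean : ∫ ω, (∑ i ∈ Finset.range n, fun ω => f (Z i ω)) ω ∂P = n * ∫ z, f z ∂ν := by
    simp only [Finset.sum_apply]
    rw [integral_finsetSum _ fun i _ => (hmem i).integrable (by norm_num)]
    simp [hE]
  rw [hvar, hmean] at hch
  refine le_trans (measure_mono ?_) (hch.trans (le_trans (ENNReal.ofReal_le_ofReal ?_) hrε))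
  · intro ω hω
    simp only [Set.mem_ofPred_eq, Finset.sum_apply] at hω ⊢
    have h1 : ∑ i ∈ Finset.range n, f (Z i ω) - n * ∫ z, f z ∂ν
        = n * (empMean f (fun i => Z i ω) n - ∫ z, f z ∂ν) := by
      rw [empMean, smul_eq_mul]; field_simp
    rw [h1, abs_mul, abs_of_pos hn']
    calc M * √n ≤ √n * |empMean f (fun i => Z i ω) n - ∫ z, f z ∂ν| * √n := by gcongr
      _ = (√n * √n) * |empMean f (fun i => Z i ω) n - ∫ z, f z ∂ν| := by ring
      _ = n * |empMean f (fun i => Z i ω) n - ∫ z, f z ∂ν| := by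
        rw [Real.mul_self_sqrt hn'.le]
  · rw [mul_pow, Real.sq_sqrt hn'.le, hM2]
    have : (n : ℝ) * v / ((v + 1) / r * n) = r * (v / (v + 1)) := by
      field_simp
    rw [this]
    exact mul_le_of_le_one_right hr0.le ((div_le_one (by positivity)).2 (by linarith))

lemma boundedInProb_complex [IsProbabilityMeasure P] [IsFiniteMeasure ν]
    (hZm : ∀ i, AEMeasurable (Z i) P) (hind : iIndepFun Z P) (hlaw : ∀ i, P.map (Z i) = ν)
    {f : ℂ → ℂ} (hf : Measurable f) (hb : ∀ z, ‖f z‖ ≤ 1) :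
    BoundedInProb P (fun n ω => √(n : ℝ) * ‖empMean f (fun i => Z i ω) n - ∫ z, f z ∂ν‖) := by
  have hint : Integrable f ν := integrable_of_norm_le_one hf.aestronglyMeasurable hb
  have h1 := boundedInProb_real hZm hind hlaw (f := fun z => (f z).re) (by fun_prop)
    (fun z => (Complex.abs_re_le_norm _).trans (hb z))
  have h2 := boundedInProb_real hZm hind hlaw (f := fun z => (f z).im) (by fun_prop)
    (fun z => (Complex.abs_im_le_norm _).trans (hb z))
  refine (h1.add h2).mono fun n ω => ?_
  rw [← mul_add]
  refine mul_le_mul_of_nonneg_left ?_ (Real.sqrt_nonneg _)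
  refine (Complex.norm_le_abs_re_add_abs_im _).trans (le_of_eq ?_)
  have e1 : (∫ z, f z ∂ν).re = ∫ z, (f z).re ∂ν := (integral_re hint).symm
  have e2 : (∫ z, f z ∂ν).im = ∫ z, (f z).im ∂ν := (integral_im hint).symm
  simp [empMean, e1, e2]

end Sequences

/-! ### Limit theorem with the centre estimated by the spatial median. -/

section Asymptotics


variable {Ω : Type*} [MeasurableSpace Ω] {P : Measure Ω} {ν : Measure ℂ} {Z : ℕ → Ω → ℂ} {ζ : ℂ}

/-- Almost surely, centring at the median instead of the symmetry centre changes the mean squared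
sign by less than the order of the mean sign. -/
lemma HasSignMean.ae_signSq_median [IsProbabilityMeasure P] (h : HasSignMean ν ζ)
    (hZm : ∀ i, AEMeasurable (Z i) P) (hind : iIndepFun Z P) (hlaw : ∀ i, P.map (Z i) = ν)
    {T : ℕ → Ω → ℂ} (hT : ∀ n, ∀ᵐ ω ∂P, ∀ m',
      ∑ i ∈ Finset.range n, ‖Z i ω - T n ω‖ ≤ ∑ i ∈ Finset.range n, ‖Z i ω - m'‖) :
    ∀ᵐ ω ∂P, Tendsto (empMean complexSign (fun i => Z i ω)) atTop (𝓝 0) ∧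
      Tendsto (empMean signSq (fun i => Z i ω)) atTop (𝓝 ζ) ∧
      ∀ δ : ℝ, 0 < δ → ∀ᶠ n in atTop,
        ‖empMean (fun w => signSq (w - T n ω)) (fun i => Z i ω) n
          - empMean signSq (fun i => Z i ω) n‖
        ≤ δ * ‖empMean complexSign (fun i => Z i ω) n‖ := by
  have := h.isProbabilityMeasure
  have hcm := measurable_conj_complex
  have hbm : Measurable fun z : ℂ => (1 + ‖z‖)⁻¹ := by fun_prop
  have hb : ∀ z : ℂ, ‖(1 + ‖z‖)⁻¹‖ ≤ 1 := fun z => by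
    rw [Real.norm_of_nonneg (by positivity)]
    exact inv_le_one_of_one_le₀ (by linarith [norm_nonneg z])
  have hg := ae_tendsto_empMean hZm hind hlaw measurable_complexSign
    (integrable_of_norm_le_one measurable_complexSign.aestronglyMeasurable norm_complexSign_le)
  have hs := ae_tendsto_empMean hZm hind hlaw measurable_signSq
    (integrable_of_norm_le_one measurable_signSq.aestronglyMeasurable fun z => (norm_signSq z).le)
  have ha := ae_tendsto_empMean hZm hind hlaw hbm
    (integrable_of_norm_le_one hbm.aestronglyMeasurable hb)
  have hcm' : Measurable fun z : ℂ => (1 + ‖z‖)⁻¹ • conj (signSq z) :=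
    hbm.smul (hcm.comp measurable_signSq)
  have hc := ae_tendsto_empMean hZm hind hlaw hcm'
    (integrable_of_norm_le_one hcm'.aestronglyMeasurable fun z => by
      rw [norm_smul, RCLike.norm_conj, norm_signSq, mul_one]; exact hb z)
  have hum : Measurable fun w : ℂ => w / conj w ^ 2 := measurable_id.div (hcm.pow_const 2)
  have hvm : Measurable fun w : ℂ => 1 / conj w := measurable_const.div hcm
  have hu := ae_tendsto_empMean hZm hind hlaw hum
    (h.integrable_inv.mono' hum.aestronglyMeasurable (.of_forall fun z => by
      rw [norm_div, norm_pow, RCLike.norm_conj]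
      rcases eq_or_ne ‖z‖ 0 with h0 | h0
      · simp [h0]
      · apply le_of_eq; field_simp))
  have hv := ae_tendsto_empMean hZm hind hlaw hvm
    (h.integrable_inv.mono' hvm.aestronglyMeasurable (.of_forall fun z => by simp))
  have hr : ∀ᵐ ω ∂P, ∀ k : ℕ, Tendsto (empMean (remKernel (1 / ((k : ℝ) + 1))) (fun i => Z i ω))
      atTop (𝓝 (∫ z, remKernel (1 / ((k : ℝ) + 1)) z ∂ν)) :=
    ae_all_iff.2 fun k => ae_tendsto_empMean hZm hind hlaw (measurable_remKernel _)
      (h.integrable_remKernel (by positivity))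
  have hz : ∀ᵐ ω ∂P, ∀ i, Z i ω ≠ 0 := ae_all_iff.2 fun i => by
    have := h.ae_ne_zero
    rw [← hlaw i] at this
    exact ae_of_ae_map (hZm i) this
  have hT' := ae_all_iff.2 hT
  -- Symmetry of the law kills the mean sign and both first-order coefficients of the expansion in
  -- `m`.
  rw [h.integral_eq_zero_of_odd fun z => by simp [complexSign, neg_div]] at hg
  rw [h.integral_eq_zero_of_odd fun z => by simp [neg_div]] at hu
  rw [h.integral_eq_zero_of_odd fun z => by simp [inv_neg]] at hv
  rw [h.integral_signSq] at hs
  filter_upwards [hg, hs, ha, hc, hu, hv, hr, hz, hT'] with ω hg hs ha hc hu hv hr hz hT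
  obtain ⟨K, hK, hKm⟩ := eventually_norm_median_le hz hT h.curvature_pos hg ha hc
  exact ⟨hg, hs, fun δ hδ => eventually_norm_empMean_signSq_sub_le hz hK hKm hg hu hv hr
    h.tendsto_integral_remKernel hδ⟩

lemma aemeasurable_empMean {f : ℂ → ℂ} (hf : Measurable f)
    (hZm : ∀ i, AEMeasurable (Z i) P) {T : Ω → ℂ} (hT : AEMeasurable T P) (n : ℕ) :
    AEMeasurable (fun ω => empMean (fun w => f (w - T ω)) (fun i => Z i ω) n) P := by
  unfold empMean
  refine AEMeasurable.const_smul ?_ _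
  exact Finset.aemeasurable_fun_sum _ fun i _ => hf.comp_aemeasurable ((hZm i).sub hT)

/-- Consistency and asymptotic normality of a smooth function of the mean squared sign with the
location estimated by the spatial median. -/
theorem HasSignMean.asymptotics [IsProbabilityMeasure P] (h : HasSignMean ν ζ)
    (hZm : ∀ i, AEMeasurable (Z i) P) (hind : iIndepFun Z P) (hlaw : ∀ i, P.map (Z i) = ν)
    {T : ℕ → Ω → ℂ} (hTm : ∀ n, AEMeasurable (T n) P) (hT : ∀ n, ∀ᵐ ω ∂P, ∀ m',
      ∑ i ∈ Finset.range n, ‖Z i ω - T n ω‖ ≤ ∑ i ∈ Finset.range n, ‖Z i ω - m'‖)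
    {Φ : ℂ → ℝ} (hΦm : Measurable Φ) {L : ℂ →L[ℝ] ℝ} (hΦ : HasFDerivAt Φ L ζ) :
    (∀ᵐ ω ∂P, Tendsto (fun n => Φ (empMean (fun w => signSq (w - T n ω)) (fun i => Z i ω) n))
      atTop (𝓝 (Φ ζ))) ∧
    TendstoInDistribution (fun (n : ℕ) ω => √(n : ℝ) *
      (Φ (empMean (fun w => signSq (w - T n ω)) (fun i => Z i ω) n) - Φ ζ)) atTop
      (id : ℝ → ℝ) (fun _ => P)
      (gaussianReal 0 ((L 1 ^ 2 + L Complex.I ^ 2) * (1 - ‖ζ‖ ^ 2) / 2).toNNReal) := by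
  have := h.isProbabilityMeasure
  have hmed := h.ae_signSq_median hZm hind hlaw hT
  have hdel : ∀ᵐ ω ∂P, Tendsto (fun n => empMean (fun w => signSq (w - T n ω)) (fun i => Z i ω) n)
      atTop (𝓝 ζ) ∧ ∀ δ : ℝ, 0 < δ → ∀ᶠ n in atTop,
      |Φ (empMean (fun w => signSq (w - T n ω)) (fun i => Z i ω) n) - Φ ζ
        - L (empMean signSq (fun i => Z i ω) n - ζ)| ≤
      δ * (‖empMean complexSign (fun i => Z i ω) n‖ + ‖empMean signSq (fun i => Z i ω) n - ζ‖) := by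
    filter_upwards [hmed] with ω hω
    exact eventually_abs_delta_le (by simpa using hω.1.norm) hω.2.1 hω.2.2 hΦ
  refine ⟨?_, ?_⟩
  · filter_upwards [hdel] with ω hω
    exact hΦ.continuousAt.tendsto.comp hω.1
  have hLm : Measurable fun z => L (signSq z) := L.measurable.comp measurable_signSq
  have hLE : ∫ ω, L (signSq (Z 0 ω)) ∂P = L ζ := by
    have h1 : ∫ ω, L (signSq (Z 0 ω)) ∂P = ∫ z, L (signSq z) ∂ν := by
      rw [← hlaw 0, integral_map (hZm 0) hLm.aestronglyMeasurable]
    rw [h1, L.integral_comp_comm (integrable_of_norm_le_one measurable_signSq.aestronglyMeasurable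
      fun z => (norm_signSq z).le), h.integral_signSq]
  have hLV : Var[fun ω => L (signSq (Z 0 ω)); P]
      = (L 1 ^ 2 + L Complex.I ^ 2) * (1 - ‖ζ‖ ^ 2) / 2 := by
    rw [← h.variance_comp_signSq L, ← hlaw 0, variance_map hLm.aemeasurable (hZm 0)]
    rfl
  have hclt := tendstoInDistribution_inv_sqrt_mul_sum_sub (P := P)
    (X := fun i ω => L (signSq (Z i ω))) (Y := (id : ℝ → ℝ))
    (P' := gaussianReal 0 ((L 1 ^ 2 + L Complex.I ^ 2) * (1 - ‖ζ‖ ^ 2) / 2).toNNReal)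
    (by rw [hLV]; exact HasLaw.id)
    (MemLp.of_bound (hLm.comp_aemeasurable (hZm 0)).aestronglyMeasurable ‖L‖
      (.of_forall fun ω => by simpa [norm_signSq] using L.le_opNorm (signSq (Z 0 ω))))
    (hind.comp (fun _ z => L (signSq z)) fun _ => hLm)
    (fun i => identDistrib_comp_of_law hZm hlaw hLm i 0)
  rw [hLE] at hclt
  have hYm : ∀ n : ℕ, AEMeasurable (fun ω => √(n : ℝ) *
      (Φ (empMean (fun w => signSq (w - T n ω)) (fun i => Z i ω) n) - Φ ζ)) P := fun n =>
    ((hΦm.comp_aemeasurable (aemeasurable_empMean measurable_signSq hZm (hTm n) n)).sub_const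
      _).const_mul _
  -- Slutsky: the statistic differs from the linearised sum at the true centre by a term that tends
  -- to `0` in measure.
  refine tendstoInDistribution_of_tendstoInMeasure_sub _ _ hclt ?_ hYm
  have hm0 : ∀ (f : ℂ → ℂ), Measurable f → ∀ n,
      AEMeasurable (fun ω => empMean f (fun i => Z i ω) n) P := fun f hf n => by
    simpa using aemeasurable_empMean hf hZm (T := fun _ => 0) aemeasurable_const n
  have hid : ∀ (n : ℕ) ω, (√(n : ℝ))⁻¹ * (∑ k ∈ Finset.range n, L (signSq (Z k ω)) - n * L ζ)
      = √(n : ℝ) * L (empMean signSq (fun i => Z i ω) n - ζ) := fun n ω => by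
    rcases Nat.eq_zero_or_pos n with rfl | hn
    · simp
    have hn' : (0 : ℝ) < n := by exact_mod_cast hn
    have hs : √(n : ℝ) ≠ 0 := (Real.sqrt_pos.2 hn').ne'
    rw [map_sub, empMean, map_smul, map_sum, smul_eq_mul, inv_mul_eq_div, div_eq_iff hs,
      mul_right_comm, Real.mul_self_sqrt hn'.le]
    field_simp
  refine tendstoInMeasure_zero_of_eventually_le
    (B := fun n ω => √(n : ℝ) * ‖empMean complexSign (fun i => Z i ω) n - ∫ z, complexSign z ∂ν‖
      + √(n : ℝ) * ‖empMean signSq (fun i => Z i ω) n - ∫ z, signSq z ∂ν‖)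
    (fun n => (hYm n).sub (hclt.forall_aemeasurable n)) (fun n => ?_)
    ((boundedInProb_complex hZm hind hlaw measurable_complexSign norm_complexSign_le).add
      (boundedInProb_complex hZm hind hlaw measurable_signSq fun z => (norm_signSq z).le)) ?_
  · exact (((hm0 _ measurable_complexSign n).sub_const _).norm.const_mul _).add
      (((hm0 _ measurable_signSq n).sub_const _).norm.const_mul _)
  · rw [h.integral_eq_zero_of_odd fun z => by simp [complexSign, neg_div], h.integral_signSq]
    filter_upwards [hdel] with ω hω δ hδ
    filter_upwards [hω.2 δ hδ] with n hn
    simp only [Pi.sub_apply, sub_zero]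
    rw [hid, ← mul_sub, abs_mul, abs_of_nonneg (Real.sqrt_nonneg _), ← mul_add, mul_left_comm]
    exact mul_le_mul_of_nonneg_left hn (Real.sqrt_nonneg _)

end Asymptotics

/-! ### Moments of the squared sign under an elliptical density. -/

lemma map_withDensity_comp {α β : Type*} [MeasurableSpace α] [MeasurableSpace β] (m : Measure α)
    {f : α → β} (hf : Measurable f) {h : β → ℝ≥0∞} (hh : Measurable h) :
    (m.withDensity fun x => h (f x)).map f = (m.map f).withDensity h := by
  ext s hs
  rw [Measure.map_apply hf hs, withDensity_apply _ (hf hs), withDensity_apply _ hs,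
    setLIntegral_map hs hh hf]

/-- The mean value property for the Möbius transformation describing the squared sign of an ellipse. -/
lemma circleAverage_moebius_pow {ζ u : ℂ} (hζ : ‖ζ‖ < 1) (hu : u ≠ 0) (k : ℕ) :
    Real.circleAverage (fun y => signSq (y * u + ζ * conj (y * u)) ^ k) 0 1 = ζ ^ k := by
  have hu' : 0 < ‖u‖ := norm_pos_iff.2 hu
  have hcu : conj u ≠ 0 := by simpa using hu
  have hden : ∀ y : ℂ, ‖y‖ ≤ 1 → conj u + conj ζ * y ^ 2 * u ≠ 0 := by
    intro y hy h0
    have h1 : ‖conj u‖ = ‖conj ζ * y ^ 2 * u‖ := by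
      rw [eq_neg_of_add_eq_zero_left h0, norm_neg]
    rw [norm_mul, norm_mul, norm_pow, RCLike.norm_conj, RCLike.norm_conj] at h1
    have h2 : ‖ζ‖ * ‖y‖ ^ 2 ≤ ‖ζ‖ * 1 := by
      gcongr; exact pow_le_one₀ (norm_nonneg _) hy
    nlinarith
  -- On the unit circle `conj y = y⁻¹`, so multiplying numerator and denominator of the squared sign
  -- by `y` gives this function of `y`. It is holomorphic on the closed disc because `‖ζ‖ < 1` keeps
  -- the denominator nonzero, and its value at `0` is `ζ ^ k`.
  have hdiff : DiffContOnCl ℂ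
      (fun y : ℂ => ((y ^ 2 * u + ζ * conj u) / (conj u + conj ζ * y ^ 2 * u)) ^ k)
      (Metric.ball 0 |1|) := by
    refine DifferentiableOn.diffContOnCl fun y hy => ?_
    have hy1 : ‖y‖ ≤ 1 := by
      have := Metric.closure_ball_subset_closedBall hy
      simpa using this
    have := hden y hy1
    exact DifferentiableAt.differentiableWithinAt (by fun_prop (disch := assumption))
  have hval := hdiff.circleAverage
  rw [Real.circleAverage_congr_sphere (f₂ := fun y : ℂ =>
    ((y ^ 2 * u + ζ * conj u) / (conj u + conj ζ * y ^ 2 * u)) ^ k), hval]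
  · simp [hcu]
  · intro y hy
    have hy1 : ‖y‖ = 1 := by simpa using hy
    have hyc : y * conj y = 1 := by
      rw [Complex.mul_conj, Complex.normSq_eq_norm_sq, hy1]; simp
    have hy0 : y ≠ 0 := fun h => by simp [h] at hy1
    have hd := hden y hy1.le
    have hcw : conj (y * u + ζ * conj (y * u)) * y = conj u + conj ζ * y ^ 2 * u := by
      simp only [map_add, map_mul, Complex.conj_conj]
      linear_combination conj u * hyc
    have hw : (y * u + ζ * conj (y * u)) * y = y ^ 2 * u + ζ * conj u := by
      simp only [map_mul]
      linear_combination ζ * conj u * hyc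
    have hne : y * u + ζ * conj (y * u) ≠ 0 := fun h => hd (by rw [← hcw, h]; simp)
    simp only
    rw [signSq_of_ne hne, ← mul_div_mul_right _ _ hy0, hcw, hw]

/-- Rotation invariance allows averaging the integrand over all rotations; after Fubini the inner
average is a circle average, equal to `ζ ^ k` for every `u ≠ 0`. -/
lemma integral_signSq_pow_of_map_mul_eq {m : Measure ℂ} [IsProbabilityMeasure m]
    (hrot : ∀ c : ℂ, ‖c‖ = 1 → m.map (fun u => c * u) = m) (h0 : ∀ᵐ u ∂m, u ≠ 0)
    {ζ : ℂ} (hζ : ‖ζ‖ < 1) (k : ℕ) :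
    ∫ u, signSq (u + ζ * conj u) ^ k ∂m = ζ ^ k := by
  set f : ℂ → ℂ := fun u => signSq (u + ζ * conj u) ^ k with hf
  have hfm : Measurable f :=
    (measurable_signSq.comp (measurable_id.add (measurable_conj_complex.const_mul ζ))).pow_const k
  have hfb : ∀ u, ‖f u‖ ≤ 1 := fun u => by rw [hf]; simp [norm_signSq]
  have h1 : ∀ θ : ℝ, ∫ u, f (circleMap 0 1 θ * u) ∂m = ∫ u, f u ∂m := fun θ => by
    conv_rhs => rw [← hrot (circleMap 0 1 θ) (by simp)]
    rw [integral_map (by fun_prop) hfm.aestronglyMeasurable]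
  have h2 : ∫ u, (∫ θ in (0 : ℝ)..2 * Real.pi, f (circleMap 0 1 θ * u)) ∂m
      = ∫ θ in (0 : ℝ)..2 * Real.pi, ∫ u, f (circleMap 0 1 θ * u) ∂m := by
    simp only [intervalIntegral.integral_of_le Real.two_pi_pos.le]
    refine integral_integral_swap (f := fun u θ => f (circleMap 0 1 θ * u)) ?_
    refine Integrable.of_bound (Measurable.aestronglyMeasurable ?_) 1 (.of_forall fun p => hfb _)
    refine hfm.comp (Measurable.mul ?_ measurable_fst)
    exact (continuous_circleMap 0 1).measurable.comp measurable_snd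
  have h3 : ∫ u, (∫ θ in (0 : ℝ)..2 * Real.pi, f (circleMap 0 1 θ * u)) ∂m
      = (2 * Real.pi : ℝ) • ζ ^ k := by
    rw [integral_congr_ae (g := fun _ => (2 * Real.pi : ℝ) • ζ ^ k)]
    · simp
    · filter_upwards [h0] with u hu
      have := circleAverage_moebius_pow hζ hu k
      rw [Real.circleAverage_def] at this
      rw [← this, smul_inv_smul₀ Real.two_pi_pos.ne']
  simp only [h1, intervalIntegral.integral_const, sub_zero] at h2
  rw [h3] at h2
  exact (smul_right_injective ℂ Real.two_pi_pos.ne' h2).symm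

/-- The linear map `w ↦ w - ζ * conj w` of the plane. -/
noncomputable def shear (ζ : ℂ) : ℂ →ₗ[ℝ] ℂ :=
  LinearMap.id - (LinearMap.mulLeft ℝ ζ) ∘ₗ Complex.conjAe.toLinearMap

lemma shear_apply (ζ w : ℂ) : shear ζ w = w - ζ * conj w := by simp [shear]

/-- Up to a real factor, positive when `‖ζ‖ < 1`, `u ↦ u + ζ * conj u` inverts the shear; the
squared sign does not see that factor. -/
lemma shear_add (ζ w : ℂ) : shear ζ w + ζ * conj (shear ζ w) = ((1 - ‖ζ‖ ^ 2 : ℝ) : ℂ) * w := by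
  rw [shear_apply, ← Complex.normSq_eq_norm_sq]
  push_cast
  rw [← Complex.mul_conj]
  simp only [map_sub, map_mul, Complex.conj_conj]
  ring

lemma signSq_shear_add {ζ : ℂ} (hζ : ‖ζ‖ < 1) (w : ℂ) :
    signSq (shear ζ w + ζ * conj (shear ζ w)) = signSq w := by
  have hr : (0 : ℝ) < 1 - ‖ζ‖ ^ 2 := by nlinarith [norm_nonneg ζ]
  rw [shear_add]
  have hr' : ((1 - ‖ζ‖ ^ 2 : ℝ) : ℂ) ≠ 0 := by exact_mod_cast hr.ne'
  unfold signSq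
  rw [map_mul, Complex.conj_ofReal, mul_div_mul_left _ _ hr']
  simp only [mul_eq_zero, hr', false_or]

lemma shear_injective {ζ : ℂ} (hζ : ‖ζ‖ < 1) : Function.Injective (shear ζ) := by
  have hr : (0 : ℝ) < 1 - ‖ζ‖ ^ 2 := by nlinarith [norm_nonneg ζ]
  rw [injective_iff_map_eq_zero]
  intro w hw
  have h := shear_add ζ w
  rw [hw] at h
  have hr' : ((1 - ‖ζ‖ ^ 2 : ℝ) : ℂ) ≠ 0 := by exact_mod_cast hr.ne'
  rw [map_zero, mul_zero, add_zero] at h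
  exact (mul_eq_zero.1 h.symm).resolve_left hr'

/-- A law with a density depending only on `‖w - ζ * conj w‖` has sign mean `ζ`. -/
lemma hasSignMean_of_density {ν : Measure ℂ} [IsProbabilityMeasure ν] {ζ : ℂ} (hζ : ‖ζ‖ < 1)
    {D : ℝ → ℝ≥0∞} (hD : Measurable D)
    (hν : ν = volume.withDensity fun w => D ‖w - ζ * conj w‖)
    (hinv : Integrable (fun z : ℂ => ‖z‖⁻¹) ν) : HasSignMean ν ζ := by
  have hac : ν ≪ volume := hν ▸ withDensity_absolutelyContinuous _ _
  have hne : ∀ᵐ z ∂ν, z ≠ 0 := hac.ae_le (volume.ae_ne 0)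
  have hsm : Measurable (shear ζ) := (shear ζ).continuous_of_finiteDimensional.measurable
  have hdet : LinearMap.det (shear ζ) ≠ 0 := by
    have := (LinearEquiv.ofInjectiveEndo (shear ζ) (shear_injective hζ)).isUnit_det'
    exact this.ne_zero
  have hDm : Measurable fun u : ℂ => D ‖u‖ := hD.comp measurable_norm
  -- The Jacobian of a linear map is constant, so the sheared law has a radial density.
  have hm : ν.map (shear ζ) = (ENNReal.ofReal |(LinearMap.det (shear ζ))⁻¹| •
      (volume : Measure ℂ)).withDensity fun u => D ‖u‖ := by
    rw [← Measure.map_linearMap_addHaar_eq_smul_addHaar volume hdet,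
      ← map_withDensity_comp volume hsm hDm, hν]
    simp only [shear_apply]
  have : IsProbabilityMeasure (ν.map (shear ζ)) :=
    Measure.isProbabilityMeasure_map hsm.aemeasurable
  have hrot : ∀ c : ℂ, ‖c‖ = 1 → (ν.map (shear ζ)).map (fun u => c * u) = ν.map (shear ζ) := by
    intro c hc
    have hcm : Measurable fun u : ℂ => c * u := by fun_prop
    have hvol : (volume : Measure ℂ).map (fun u => c * u) = volume :=
      (rotation ⟨c, by simpa [Submonoid.unitSphere] using hc⟩).measurePreserving.map_eq
    have h1 := map_withDensity_comp (ENNReal.ofReal |(LinearMap.det (shear ζ))⁻¹| •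
      (volume : Measure ℂ)) hcm hDm
    rw [Measure.map_smul, hvol] at h1
    simp only [norm_mul, hc, one_mul] at h1
    rw [hm, h1]
  have h0 : ∀ᵐ u ∂ν.map (shear ζ), u ≠ 0 := by
    rw [hm]
    refine (withDensity_absolutelyContinuous _ _).ae_le ?_
    exact Measure.ae_smul_measure (volume.ae_ne 0) _
  have hmom : ∀ k : ℕ, ∫ z, signSq z ^ k ∂ν = ζ ^ k := fun k => by
    rw [← integral_signSq_pow_of_map_mul_eq hrot h0 hζ k, integral_map hsm.aemeasurable]
    · simp only [signSq_shear_add hζ]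
    · exact ((measurable_signSq.comp (measurable_id.add
        (measurable_conj_complex.const_mul ζ))).pow_const k).aestronglyMeasurable
  refine ⟨inferInstance, ?_, hne, hinv, by simpa using hmom 1, hmom 2, hζ⟩
  have hvol : (volume : Measure ℂ).map (fun z => -z) = volume :=
    (Measure.measurePreserving_neg volume).map_eq
  have hDw : Measurable fun w : ℂ => D ‖w - ζ * conj w‖ :=
    hD.comp (measurable_id.sub (measurable_conj_complex.const_mul ζ)).norm
  have h1 := map_withDensity_comp (volume : Measure ℂ) measurable_neg hDw
  rw [hvol] at h1
  have h2 : ∀ w : ℂ, ‖-w - ζ * conj (-w)‖ = ‖w - ζ * conj w‖ := fun w => by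
    rw [map_neg, mul_neg, ← neg_sub', norm_neg]
  simp only [h2, ← hν] at h1
  exact h1

/-- A law with a density bounded near `μ` has a finite inverse moment of the distance to `μ`. -/
lemma HasBoundedDensityAt.integrable_inv {F : Measure (EuclideanSpace ℝ (Fin 2))}
    [IsFiniteMeasure F] {μ : EuclideanSpace ℝ (Fin 2)} (h : HasBoundedDensityAt F μ) :
    Integrable (fun x => ‖x - μ‖⁻¹) F := by
  obtain ⟨f, hf, rfl, C, hC⟩ := h
  obtain ⟨r, hr, hball⟩ := Metric.eventually_nhds_iff_ball.1 hC
  have hmeas : Measurable fun x : EuclideanSpace ℝ (Fin 2) => ‖x - μ‖⁻¹ := by fun_prop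
  have hvol0 : IntegrableOn (fun x : EuclideanSpace ℝ (Fin 2) => ‖x‖⁻¹) (Metric.ball 0 r) := by
    -- In polar coordinates the planar Jacobian `y` cancels the singularity `y⁻¹`.
    rw [integrableOn_fun_norm_addHaar volume (f := fun y => y⁻¹)]
    have : IntegrableOn (fun _ : ℝ => (1 : ℝ)) (Set.Ioo 0 r) := by simp
    refine this.congr_fun (fun y hy => ?_) measurableSet_Ioo
    have := hy.1.ne'
    simp [this]
  have hvol : IntegrableOn (fun x : EuclideanSpace ℝ (Fin 2) => ‖x - μ‖⁻¹) (Metric.ball μ r) := by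
    have hmp := measurePreserving_sub_right (volume : Measure (EuclideanSpace ℝ (Fin 2))) μ
    have := (hmp.integrableOn_comp_preimage
      (Homeomorph.subRight μ).measurableEmbedding).2 hvol0
    convert! this using 1
    ext x; simp [dist_eq_norm]
  rw [← integrableOn_univ, ← Set.union_compl_self (Metric.ball μ r)]
  refine IntegrableOn.union ?_ ?_
  · refine Integrable.mono_measure (ν := C • volume.restrict (Metric.ball μ r))
      (hvol.smul_measure_nnreal) ?_
    rw [restrict_withDensity Metric.isOpen_ball.measurableSet]
    refine Measure.le_iff.2 fun s hs => ?_
    rw [withDensity_apply _ hs]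
    calc ∫⁻ a in s, f a ∂volume.restrict (Metric.ball μ r)
        ≤ ∫⁻ _ in s, (C : ℝ≥0∞) ∂volume.restrict (Metric.ball μ r) := by
          refine setLIntegral_mono_ae' hs ?_
          filter_upwards [ae_restrict_mem Metric.isOpen_ball.measurableSet] with x hx _
          exact hball x hx
      _ = (C • volume.restrict (Metric.ball μ r)) s := by simp
  · refine Integrable.of_bound hmeas.aestronglyMeasurable r⁻¹ ?_
    filter_upwards [ae_restrict_mem Metric.isOpen_ball.measurableSet.compl] with x hx
    have hx' : r ≤ ‖x - μ‖ := by simpa [dist_eq_norm] using hx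
    rw [norm_inv, norm_norm]
    exact inv_anti₀ hr hx'

/-! ### The correlation coefficient as a smooth function on the unit disc. -/

/-- The spatial sign correlation as a function of the mean squared sign. -/
noncomputable def correlationOfSignMean (z : ℂ) : ℝ :=
  spatialSignCorrelation !![(1 + z.re) / 2, z.im / 2; 0, 0]

lemma measurable_correlationOfSignMean : Measurable correlationOfSignMean := by
  unfold correlationOfSignMean spatialSignCorrelation
  simp only [Matrix.of_apply, Matrix.cons_val', Matrix.cons_val_zero, Matrix.cons_val_one]
  fun_prop

/-- Here `d = 1 / 2 + r` with `r = ‖z‖ / 2`, and `s₁₂ ^ 2 + b ^ 2 = 2 * r * b`. With `q = 1 / 4 - r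
^ 2` one has `c * q = 2 * r`, so `c * b` factors out of the root and cancels. The resulting formula
is smooth on the whole disc, including the real axis, where `b` may vanish. -/
lemma correlationOfSignMean_eq {z : ℂ} (hz : ‖z‖ < 1) :
    correlationOfSignMean z
      = 2 * z.im / √((1 - z.re ^ 2 - z.im ^ 2) ^ 2 + 4 * z.im ^ 2) := by
  have hn : z.re ^ 2 + z.im ^ 2 < 1 := by
    have : z.re ^ 2 + z.im ^ 2 = ‖z‖ ^ 2 := by
      rw [← Complex.normSq_eq_norm_sq, Complex.normSq_apply]; ring
    rw [this]; nlinarith [norm_nonneg z]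
  unfold correlationOfSignMean spatialSignCorrelation
  simp only [Matrix.of_apply, Matrix.cons_val', Matrix.cons_val_zero, Matrix.cons_val_one]
  set x := z.re
  set y := z.im
  -- For `y = 0` both sides are `0`, even when `b = 0`; otherwise `r > |x| / 2`, so `b > 0` and the
  -- cancellation is legitimate.
  rcases eq_or_ne y 0 with h0 | h0
  · simp [h0]
  set r := √(((1 + x) / 2 - 1 / 2) ^ 2 + (y / 2) ^ 2) with hr
  have hr2 : r ^ 2 = (x ^ 2 + y ^ 2) / 4 := by
    rw [hr, Real.sq_sqrt (by positivity)]; ring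
  have hy2 : 0 < y ^ 2 := by positivity
  have hr0 : 0 < r := Real.sqrt_pos.2 (by positivity)
  have hq : 0 < 1 / 4 - r ^ 2 := by rw [hr2]; linarith
  have hb : 0 < r - x / 2 := by
    by_contra! hcon
    nlinarith
  have hb' : (1 / 2 + r - (1 + x) / 2) = r - x / 2 := by ring
  have hc' : (2 * (1 / 2 + r) - 1) / ((1 / 2 + r) * (1 - (1 / 2 + r))) = 2 * r / (1 / 4 - r ^ 2) := by
    congr 1 <;> ring
  rw [hb', hc']
  set q := 1 / 4 - r ^ 2 with hqd
  have hD : ((y / 2) ^ 2 + (r - x / 2) ^ 2) ^ 2 + (y / 2 * (2 * r / q) * (r - x / 2)) ^ 2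
      = ((2 * r / q) * (r - x / 2)) ^ 2 * (q ^ 2 + (y / 2) ^ 2) := by
    have h1 : (y / 2) ^ 2 + (r - x / 2) ^ 2 = 2 * r * (r - x / 2) := by
      linear_combination -hr2
    rw [h1]
    field_simp
  have hE : (1 - x ^ 2 - y ^ 2) ^ 2 + 4 * y ^ 2 = 4 ^ 2 * (q ^ 2 + (y / 2) ^ 2) := by
    have : q = (1 - x ^ 2 - y ^ 2) / 4 := by rw [hqd, hr2]; ring
    rw [this]; ring
  have hs : 0 < √(q ^ 2 + (y / 2) ^ 2) := Real.sqrt_pos.2 (by positivity)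
  rw [hD, hE, Real.sqrt_mul (by positivity), Real.sqrt_mul (by positivity),
    Real.sqrt_sq (by positivity), Real.sqrt_sq (by positivity)]
  generalize r - x / 2 = b at hb
  field_simp
  ring

/-- The derivative of the spatial sign correlation as a function of the mean squared sign. -/
lemma exists_hasFDerivAt_correlationOfSignMean {z : ℂ} (hz : ‖z‖ < 1) :
    ∃ L : ℂ →L[ℝ] ℝ, HasFDerivAt correlationOfSignMean L z ∧
      L 1 ^ 2 + L Complex.I ^ 2 = ((4 * z.re * z.im * (1 - z.re ^ 2 - z.im ^ 2)) ^ 2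
        + (2 * (1 - z.re ^ 2 - z.im ^ 2) * (1 - z.re ^ 2 + z.im ^ 2)) ^ 2)
        / ((1 - z.re ^ 2 - z.im ^ 2) ^ 2 + 4 * z.im ^ 2) ^ 3 := by
  have hn : z.re ^ 2 + z.im ^ 2 < 1 := by
    have : z.re ^ 2 + z.im ^ 2 = ‖z‖ ^ 2 := by
      rw [← Complex.normSq_eq_norm_sq, Complex.normSq_apply]; ring
    rw [this]; nlinarith [norm_nonneg z]
  have hev : correlationOfSignMean =ᶠ[𝓝 z] fun z =>
      2 * z.im * (√((1 - z.re ^ 2 - z.im ^ 2) ^ 2 + 4 * z.im ^ 2))⁻¹ := by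
    filter_upwards [continuous_norm.continuousAt.eventually_lt continuousAt_const hz] with w hw
    rw [correlationOfSignMean_eq hw, div_eq_mul_inv]
  have hQ : 0 < (1 - z.re ^ 2 - z.im ^ 2) ^ 2 + 4 * z.im ^ 2 := by
    have : 0 < (1 - z.re ^ 2 - z.im ^ 2) ^ 2 := by
      have : 0 < 1 - z.re ^ 2 - z.im ^ 2 := by linarith
      positivity
    positivity
  set s := √((1 - z.re ^ 2 - z.im ^ 2) ^ 2 + 4 * z.im ^ 2) with hs
  have hs0 : 0 < s := Real.sqrt_pos.2 hQ
  have hs2 : s ^ 2 = (1 - z.re ^ 2 - z.im ^ 2) ^ 2 + 4 * z.im ^ 2 := Real.sq_sqrt hQ.le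
  have hre : HasFDerivAt (fun w : ℂ => w.re) Complex.reCLM z := Complex.reCLM.hasFDerivAt
  have him : HasFDerivAt (fun w : ℂ => w.im) Complex.imCLM z := Complex.imCLM.hasFDerivAt
  have hQd := ((((hre.pow 2).const_sub 1).sub (him.pow 2)).pow 2).add ((him.pow 2).const_mul 4)
  have hsd := hQd.sqrt hQ.ne'
  have hinv := (hasDerivAt_inv hs0.ne').comp_hasFDerivAt z hsd
  have hfin := (him.const_mul 2).mul hinv
  refine ⟨_, hfin.congr_of_eventuallyEq hev, ?_⟩
  have hcomb : ∀ A B : ℝ, A = 4 * z.re * z.im * (1 - z.re ^ 2 - z.im ^ 2) / s ^ 3 →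
      B = 2 * (1 - z.re ^ 2 - z.im ^ 2) * (1 - z.re ^ 2 + z.im ^ 2) / s ^ 3 →
      A ^ 2 + B ^ 2 = ((4 * z.re * z.im * (1 - z.re ^ 2 - z.im ^ 2)) ^ 2
        + (2 * (1 - z.re ^ 2 - z.im ^ 2) * (1 - z.re ^ 2 + z.im ^ 2)) ^ 2)
        / ((1 - z.re ^ 2 - z.im ^ 2) ^ 2 + 4 * z.im ^ 2) ^ 3 := by
    rintro _ _ rfl rfl
    rw [← hs2]
    field_simp
  refine hcomb _ _ ?_ ?_ <;>
  simp only [add_apply, smul_apply, sub_apply, neg_apply, Pi.add_apply, Pi.sub_apply,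
    Function.comp_apply, Complex.reCLM_apply, Complex.imCLM_apply, Complex.one_re,
    Complex.one_im, Complex.I_re, Complex.I_im, smul_eq_mul, nsmul_eq_mul, Nat.cast_ofNat,
    Nat.add_one_sub_one, pow_one, ← hs]
  · field_simp
    ring
  · field_simp
    linear_combination hs2

/-! ### Passage from the sample matrix to the mean squared sign. -/

/-- The isometry of the Euclidean plane with the complex plane. -/
noncomputable def toComplex : EuclideanSpace ℝ (Fin 2) ≃ₗᵢ[ℝ] ℂ :=
  Complex.orthonormalBasisOneI.repr.symm

lemma toComplex_re (x : EuclideanSpace ℝ (Fin 2)) : (toComplex x).re = x 0 := by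
  simp [toComplex]

lemma toComplex_im (x : EuclideanSpace ℝ (Fin 2)) : (toComplex x).im = x 1 := by
  simp [toComplex]

/-- These are the double-angle formulas. They persist at `x = 0`, where the spatial sign is `0`,
precisely because `signSq 0 = -1`. -/
lemma signSq_re_im (x : EuclideanSpace ℝ (Fin 2)) :
    (spatialSign x) 0 * (spatialSign x) 0 = (1 + (signSq (toComplex x)).re) / 2 ∧
    (spatialSign x) 0 * (spatialSign x) 1 = (signSq (toComplex x)).im / 2 := by
  rcases eq_or_ne x 0 with rfl | hx
  · simp [spatialSign, signSq]
  have hw : toComplex x ≠ 0 := by simpa using hx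
  have hn : 0 < ‖x‖ := norm_pos_iff.2 hx
  have hn2 : ‖x‖ ^ 2 = x 0 ^ 2 + x 1 ^ 2 := by
    rw [EuclideanSpace.norm_sq_eq]; simp
  have hns : Complex.normSq (toComplex x) = ‖x‖ ^ 2 := by
    rw [Complex.normSq_eq_norm_sq, LinearIsometryEquiv.norm_map]
  have hs : signSq (toComplex x) = toComplex x ^ 2 / ((‖x‖ ^ 2 : ℝ) : ℂ) := by
    have : conj (toComplex x) ≠ 0 := (map_ne_zero _).2 hw
    rw [signSq_of_ne hw, ← hns, ← Complex.mul_conj]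
    field_simp
  rw [hs, Complex.div_ofReal_re, Complex.div_ofReal_im, pow_two (toComplex x), Complex.mul_re,
    Complex.mul_im, toComplex_re, toComplex_im]
  simp only [spatialSign, PiLp.smul_apply, smul_eq_mul]
  constructor
  · field_simp
    linear_combination -hn2
  · field_simp
    ring

/-- Only the first row is read, which is why `correlationOfSignMean` may fill the second with zeros.
-/
lemma spatialSignCorrelation_congr {S S' : Matrix (Fin 2) (Fin 2) ℝ} (h0 : S 0 0 = S' 0 0)
    (h1 : S 0 1 = S' 0 1) : spatialSignCorrelation S = spatialSignCorrelation S' := by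
  simp only [spatialSignCorrelation, h0, h1]

lemma spatialSignCorrelation_sscm {n : ℕ} (hn : 0 < n) (x : ℕ → EuclideanSpace ℝ (Fin 2))
    (t μ : EuclideanSpace ℝ (Fin 2)) :
    spatialSignCorrelation (sscm (fun i : Fin n => x i) t)
      = correlationOfSignMean (empMean (fun w => signSq (w - toComplex (t - μ)))
        (fun i => toComplex (x i - μ)) n) := by
  have hn' : (n : ℝ) ≠ 0 := by exact_mod_cast hn.ne'
  have hsub : ∀ i, toComplex (x i - μ) - toComplex (t - μ) = toComplex (x i - t) := fun i => by
    rw [← map_sub]; congr 1; abel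
  refine spatialSignCorrelation_congr ?_ ?_
  · simp only [sscm, Matrix.smul_apply, Matrix.sum_apply, Matrix.vecMulVec_apply, empMean, hsub,
      Complex.smul_re, Complex.re_sum, Matrix.of_apply, Matrix.cons_val', Matrix.cons_val_zero,
      smul_eq_mul, (signSq_re_im _).1]
    rw [Fin.sum_univ_eq_sum_range (fun i => (1 + (signSq (toComplex (x i - t))).re) / 2),
      ← Finset.sum_div, Finset.sum_add_distrib]
    simp only [Finset.sum_const, Finset.card_range, nsmul_eq_mul, mul_one]
    field_simp
  · simp only [sscm, Matrix.smul_apply, Matrix.sum_apply, Matrix.vecMulVec_apply, empMean, hsub,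
      Complex.smul_im, Complex.im_sum, Matrix.of_apply, Matrix.cons_val', Matrix.cons_val_zero,
      Matrix.cons_val_one, smul_eq_mul, (signSq_re_im _).2]
    rw [Fin.sum_univ_eq_sum_range (fun i => (signSq (toComplex (x i - t))).im / 2),
      ← Finset.sum_div]
    ring

/-! ### The sign mean attached to a shape matrix, and the variance algebra. -/

/-- The mean of the squared sign of an elliptical law with shape matrix `V`. -/
noncomputable def signMean (V : Matrix (Fin 2) (Fin 2) ℝ) : ℂ :=
  ⟨(V 0 0 - V 1 1) / (V 0 0 + V 1 1 + 2 * √V.det), 2 * V 0 1 / (V 0 0 + V 1 1 + 2 * √V.det)⟩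

section Shape

variable {V : Matrix (Fin 2) (Fin 2) ℝ}

lemma apply_one_zero_of_posDef (hV : V.PosDef) : V 1 0 = V 0 1 := by
  simpa using hV.isHermitian.apply 0 1

lemma det_eq_of_posDef (hV : V.PosDef) : V.det = V 0 0 * V 1 1 - V 0 1 ^ 2 := by
  rw [Matrix.det_fin_two, apply_one_zero_of_posDef hV]; ring

lemma dotProduct_inv_mulVec (hV : V.PosDef) (x : Fin 2 → ℝ) :
    x ⬝ᵥ (V⁻¹ *ᵥ x)
      = (V 1 1 * x 0 ^ 2 - 2 * V 0 1 * x 0 * x 1 + V 0 0 * x 1 ^ 2) / V.det := by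
  rw [Matrix.inv_def, Matrix.adjugate_fin_two, Ring.inverse_eq_inv', apply_one_zero_of_posDef hV]
  simp [Matrix.mulVec, dotProduct, Fin.sum_univ_two]
  ring

lemma one_sub_sq_signMean (hV : V.PosDef) :
    1 - (signMean V).re ^ 2 - (signMean V).im ^ 2
      = 4 * √V.det / (V 0 0 + V 1 1 + 2 * √V.det) := by
  have h0 : 0 < V 0 0 := hV.diag_pos
  have h1 : 0 < V 1 1 := hV.diag_pos
  have hδ : 0 < √V.det := Real.sqrt_pos.2 hV.det_pos
  have hδ2 : √V.det ^ 2 = V 0 0 * V 1 1 - V 0 1 ^ 2 := by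
    rw [Real.sq_sqrt hV.det_pos.le, det_eq_of_posDef hV]
  simp only [signMean]
  field_simp
  linear_combination -4 * hδ2

lemma norm_signMean_sq (V : Matrix (Fin 2) (Fin 2) ℝ) :
    ‖signMean V‖ ^ 2 = (signMean V).re ^ 2 + (signMean V).im ^ 2 := by
  rw [← Complex.normSq_eq_norm_sq, Complex.normSq_apply]; ring

lemma norm_signMean_lt_one (hV : V.PosDef) : ‖signMean V‖ < 1 := by
  have h0 : 0 < V 0 0 := hV.diag_pos
  have h1 : 0 < V 1 1 := hV.diag_pos
  have hδ : 0 < √V.det := Real.sqrt_pos.2 hV.det_pos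
  have hw := one_sub_sq_signMean hV
  have hpos : 0 < 4 * √V.det / (V 0 0 + V 1 1 + 2 * √V.det) := by positivity
  have : ‖signMean V‖ ^ 2 < 1 := by rw [norm_signMean_sq]; linarith
  nlinarith [norm_nonneg (signMean V)]

/-- Put `τ = (v₁₁ - v₂₂) + 2 i v₁₂`. The form is proportional to `tr V * ‖w‖ ^ 2 - Re (conj τ * w ^
2)`, while the right-hand norm squared is `(1 + ‖ζ‖ ^ 2) * ‖w‖ ^ 2 - 2 * Re (conj ζ * w ^ 2)`.
Matching ratios leads to `ζ = τ / (tr V + 2 * √(det V))`, the solution inside the unit disc. -/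
lemma quadraticForm_eq (hV : V.PosDef) (x : EuclideanSpace ℝ (Fin 2)) :
    x.ofLp ⬝ᵥ (V⁻¹ *ᵥ x.ofLp)
      = ‖toComplex x - signMean V * conj (toComplex x)‖ ^ 2
        * ((V 0 0 + V 1 1 + 2 * √V.det) / (4 * V.det)) := by
  have h0 : 0 < V 0 0 := hV.diag_pos
  have h1 : 0 < V 1 1 := hV.diag_pos
  have hδ : 0 < √V.det := Real.sqrt_pos.2 hV.det_pos
  have hδ2 : √V.det ^ 2 = V 0 0 * V 1 1 - V 0 1 ^ 2 := by
    rw [Real.sq_sqrt hV.det_pos.le, det_eq_of_posDef hV]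
  have hd := hV.det_pos
  rw [dotProduct_inv_mulVec hV, ← Complex.normSq_eq_norm_sq, Complex.normSq_apply]
  simp only [Complex.sub_re, Complex.sub_im, Complex.mul_re, Complex.mul_im, Complex.conj_re,
    Complex.conj_im, toComplex_re, toComplex_im, signMean]
  field_simp
  linear_combination (-4 * (x.ofLp 0 ^ 2 + x.ofLp 1 ^ 2)) * hδ2

/-- Read `p, q, c` as `v₁₁, v₂₂, v₁₂`, `δ` as `√(det V)` and `σ` as `√(v₁₁ v₂₂)`. Then `δ / σ` is
`√(1 - ρ ^ 2)` and `(p + q) / σ` is `a + a⁻¹`. -/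
lemma quadratic_variance_identity {p q c δ σ : ℝ} (hp : 0 < p) (hq : 0 < q) (hδ : 0 < δ)
    (hδ2 : δ ^ 2 = p * q - c ^ 2) (hσ : 0 < σ) (hσ2 : σ ^ 2 = p * q) {x y : ℝ}
    (hx : x = (p - q) / (p + q + 2 * δ)) (hy : y = 2 * c / (p + q + 2 * δ))
    (hw : 1 - x ^ 2 - y ^ 2 = 4 * δ / (p + q + 2 * δ)) :
    ((4 * x * y * (1 - x ^ 2 - y ^ 2)) ^ 2
        + (2 * (1 - x ^ 2 - y ^ 2) * (1 - x ^ 2 + y ^ 2)) ^ 2)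
        / ((1 - x ^ 2 - y ^ 2) ^ 2 + 4 * y ^ 2) ^ 3 * (1 - x ^ 2 - y ^ 2) / 2
      = (δ / σ) ^ 4 + 1 / 2 * ((p + q) / σ) * (δ / σ) ^ 3 := by
  set N := p + q + 2 * δ with hN
  have hN0 : 0 < N := by positivity
  have hD : (1 - x ^ 2 - y ^ 2) ^ 2 + 4 * y ^ 2 = 16 * σ ^ 2 / N ^ 2 := by
    rw [hw, hy]; field_simp; rw [hσ2]; linear_combination 16 * hδ2
  have hu : 1 - x ^ 2 + y ^ 2 = 4 * (δ * (p + q) + 2 * (p * q)) / N ^ 2 := by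
    have : 1 - x ^ 2 + y ^ 2 = (1 - x ^ 2 - y ^ 2) + 2 * y ^ 2 := by ring
    rw [this, hw, hy]; field_simp; rw [hN]; linear_combination 8 * hδ2
  have hxy : (4 * x * y * (1 - x ^ 2 - y ^ 2)) ^ 2
      = 1024 * (p - q) ^ 2 * (p * q - δ ^ 2) * δ ^ 2 / N ^ 6 := by
    rw [hw, hx, hy, show p * q - δ ^ 2 = c ^ 2 by linarith]; field_simp; ring
  rw [hD, hxy, hu, hw]
  -- The squared gradient collapses here: its numerator contains the perfect square `N ^ 2`, which
  -- leaves a sum of only two terms at the end.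
  have hE : (p - q) ^ 2 * (p * q - δ ^ 2) + (δ * (p + q) + 2 * (p * q)) ^ 2 = σ ^ 2 * N ^ 2 := by
    rw [hσ2, hN]; ring
  have hfac : 1024 * (p - q) ^ 2 * (p * q - δ ^ 2) * δ ^ 2 / N ^ 6
      + (2 * (4 * δ / N) * (4 * (δ * (p + q) + 2 * (p * q)) / N ^ 2)) ^ 2
      = 1024 * δ ^ 2 / N ^ 6 * (σ ^ 2 * N ^ 2) := by
    rw [← hE]; field_simp; ring
  rw [hfac]
  field_simp
  rw [hN]
  ring

end Shape

/-- The centred elliptical law has sign mean `signMean V`. -/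
lemma IsElliptical.hasSignMean {μ : EuclideanSpace ℝ (Fin 2)} {V : Matrix (Fin 2) (Fin 2) ℝ}
    {F : Measure (EuclideanSpace ℝ (Fin 2))} (hF : IsElliptical μ V F)
    (hbdd : HasBoundedDensityAt F μ) :
    HasSignMean (F.map fun x => toComplex (x - μ)) (signMean V) := by
  have := hF.isProbabilityMeasure
  have hV := hF.posDef
  obtain ⟨g, hg, -, hFg⟩ := hF.exists_generator
  have hmp : MeasurePreserving (fun x : EuclideanSpace ℝ (Fin 2) => toComplex (x - μ)) :=
    toComplex.measurePreserving.comp (measurePreserving_sub_right volume μ)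
  have : IsProbabilityMeasure (F.map fun x => toComplex (x - μ)) :=
    Measure.isProbabilityMeasure_map hmp.measurable.aemeasurable
  set D : ℝ → ℝ≥0∞ := fun r => ENNReal.ofReal ((√V.det)⁻¹ *
    g (r ^ 2 * ((V 0 0 + V 1 1 + 2 * √V.det) / (4 * V.det)))) with hDdef
  have hD : Measurable D :=
    ((hg.comp (by fun_prop)).const_mul _).ennreal_ofReal
  refine hasSignMean_of_density (norm_signMean_lt_one hV) hD ?_ ?_
  · have hDw : Measurable fun w : ℂ => D ‖w - signMean V * conj w‖ :=
      hD.comp (measurable_id.sub (measurable_conj_complex.const_mul _)).norm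
    have h1 := map_withDensity_comp volume hmp.measurable hDw
    rw [hmp.map_eq] at h1
    rw [← h1, hFg]
    simp only [hDdef, quadraticForm_eq hV]
  · rw [integrable_map_measure (by fun_prop : Measurable fun z : ℂ => ‖z‖⁻¹).aestronglyMeasurable
      hmp.measurable.aemeasurable]
    refine hbdd.integrable_inv.congr (.of_forall fun x => ?_)
    simp only [Function.comp_apply, LinearIsometryEquiv.norm_map]

lemma correlationOfSignMean_signMean {V : Matrix (Fin 2) (Fin 2) ℝ} (hV : V.PosDef) :
    correlationOfSignMean (signMean V) = generalizedCorrelation V := by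
  have h0 : 0 < V 0 0 := hV.diag_pos
  have h1 : 0 < V 1 1 := hV.diag_pos
  have hδ : 0 < √V.det := Real.sqrt_pos.2 hV.det_pos
  have hδ2 : √V.det ^ 2 = V 0 0 * V 1 1 - V 0 1 ^ 2 := by
    rw [Real.sq_sqrt hV.det_pos.le, det_eq_of_posDef hV]
  have hN : 0 < V 0 0 + V 1 1 + 2 * √V.det := by positivity
  have hσ : 0 < √(V 0 0 * V 1 1) := Real.sqrt_pos.2 (by positivity)
  rw [correlationOfSignMean_eq (norm_signMean_lt_one hV), one_sub_sq_signMean hV,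
    generalizedCorrelation]
  simp only [signMean]
  generalize V 0 0 + V 1 1 + 2 * √V.det = N at hN
  have hD : (4 * √V.det / N) ^ 2 + 4 * (2 * V 0 1 / N) ^ 2
      = (4 / N) ^ 2 * (V 0 0 * V 1 1) := by
    field_simp
    linear_combination 4 * hδ2
  rw [hD, Real.sqrt_mul (by positivity), Real.sqrt_sq (by positivity)]
  field_simp
  ring

lemma asymptoticVariance_eq {V : Matrix (Fin 2) (Fin 2) ℝ} (hV : V.PosDef) {L : ℂ →L[ℝ] ℝ}
    (hL : L 1 ^ 2 + L Complex.I ^ 2 = ((4 * (signMean V).re * (signMean V).im *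
          (1 - (signMean V).re ^ 2 - (signMean V).im ^ 2)) ^ 2
        + (2 * (1 - (signMean V).re ^ 2 - (signMean V).im ^ 2)
          * (1 - (signMean V).re ^ 2 + (signMean V).im ^ 2)) ^ 2)
        / ((1 - (signMean V).re ^ 2 - (signMean V).im ^ 2) ^ 2 + 4 * (signMean V).im ^ 2) ^ 3) :
    (L 1 ^ 2 + L Complex.I ^ 2) * (1 - ‖signMean V‖ ^ 2) / 2
      = asymptoticVariance (generalizedCorrelation V) (√(V 0 0 / V 1 1)) := by
  have h0 : 0 < V 0 0 := hV.diag_pos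
  have h1 : 0 < V 1 1 := hV.diag_pos
  have hδ : 0 < √V.det := Real.sqrt_pos.2 hV.det_pos
  have hδ2 : √V.det ^ 2 = V 0 0 * V 1 1 - V 0 1 ^ 2 := by
    rw [Real.sq_sqrt hV.det_pos.le, det_eq_of_posDef hV]
  have hσ : 0 < √(V 0 0 * V 1 1) := Real.sqrt_pos.2 (by positivity)
  have hσ2 : √(V 0 0 * V 1 1) ^ 2 = V 0 0 * V 1 1 := Real.sq_sqrt (by positivity)
  rw [norm_signMean_sq, ← sub_sub, hL, quadratic_variance_identity h0 h1 hδ hδ2 hσ hσ2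
    (x := (signMean V).re) (y := (signMean V).im) rfl rfl (one_sub_sq_signMean hV)]
  have hρ : 1 - generalizedCorrelation V ^ 2 = (√V.det / √(V 0 0 * V 1 1)) ^ 2 := by
    rw [generalizedCorrelation, div_pow, div_pow, hδ2]
    field_simp
    rw [hσ2]
  have ha : √(V 0 0 / V 1 1) + (√(V 0 0 / V 1 1))⁻¹ = (V 0 0 + V 1 1) / √(V 0 0 * V 1 1) := by
    rw [Real.sqrt_div h0.le, Real.sqrt_mul h0.le]
    have s0 : 0 < √(V 0 0) := Real.sqrt_pos.2 h0
    have s1 : 0 < √(V 1 1) := Real.sqrt_pos.2 h1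
    field_simp
    rw [Real.sq_sqrt h0.le, Real.sq_sqrt h1.le]
  have hpow : ((√V.det / √(V 0 0 * V 1 1)) ^ 2) ^ (3 / 2 : ℝ)
      = (√V.det / √(V 0 0 * V 1 1)) ^ 3 := by
    rw [← Real.rpow_natCast, ← Real.rpow_mul (by positivity), ← Real.rpow_natCast]
    norm_num
  rw [asymptoticVariance, hρ, ha, hpow]
  ring

end SpatialSign

/-! ### The theorem. -/

open SpatialSign in
theorem proposition3
    {Ω : Type*} [MeasurableSpace Ω] (P : Measure Ω) [IsProbabilityMeasure P]
    (μ : EuclideanSpace ℝ (Fin 2)) (V : Matrix (Fin 2) (Fin 2) ℝ)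
    (F : Measure (EuclideanSpace ℝ (Fin 2)))
    (hF : SpatialSign.IsElliptical μ V F)
    (hbdd : SpatialSign.HasBoundedDensityAt F μ)
    -- an i.i.d. sequence with distribution `F`
    (X : ℕ → Ω → EuclideanSpace ℝ (Fin 2))
    (hXm : ∀ i, AEMeasurable (X i) P)
    (hXind : iIndepFun X P)
    (hXlaw : ∀ i, P.map (X i) = F)
    -- the empirical spatial median of the first `n` observations
    (T : ℕ → Ω → EuclideanSpace ℝ (Fin 2))
    (hTm : ∀ n, AEMeasurable (T n) P)
    (hT : ∀ n, ∀ᵐ ω ∂P, SpatialSign.IsSpatialMedian (fun i : Fin n => X i ω) (T n ω))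
    -- the spatial sign correlation of the first `n` observations
    (ρhat : ℕ → Ω → ℝ)
    (hρhat : ∀ n ω, ρhat n ω = SpatialSign.spatialSignCorrelation
      (SpatialSign.sscm (fun i : Fin n => X i ω) (T n ω)))
    (ρ a : ℝ)
    (hρ : ρ = SpatialSign.generalizedCorrelation V)
    (ha : a = √(V 0 0 / V 1 1)) :
    (∀ᵐ ω ∂P, Tendsto (fun n => ρhat n ω) atTop (𝓝 ρ)) ∧
    TendstoInDistribution (fun (n : ℕ) ω => √(n : ℝ) * (ρhat n ω - ρ)) atTop
      (id : ℝ → ℝ) (fun _ => P)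
      (gaussianReal 0 (SpatialSign.asymptoticVariance ρ a).toNNReal) := by
  have hV := hF.posDef
  have hlaw := hF.hasSignMean hbdd
  obtain ⟨L, hL, hLsq⟩ := exists_hasFDerivAt_correlationOfSignMean (norm_signMean_lt_one hV)
  have hcm : Measurable fun x : EuclideanSpace ℝ (Fin 2) => toComplex (x - μ) :=
    toComplex.continuous.measurable.comp (measurable_id.sub_const μ)
  have hmain := hlaw.asymptotics (P := P) (Z := fun i ω => toComplex (X i ω - μ))
    (fun i => hcm.comp_aemeasurable (hXm i)) (hXind.comp (fun _ x => toComplex (x - μ)) fun _ => hcm)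
    (fun i => by
      rw [← hXlaw i, AEMeasurable.map_map_of_aemeasurable hcm.aemeasurable (hXm i)]
      rfl)
    (T := fun n ω => toComplex (T n ω - μ)) (fun n => hcm.comp_aemeasurable (hTm n))
    (fun n => by
      -- Translation by `-μ` followed by an isometry preserves distances, so it carries spatial
      -- medians to spatial medians.
      filter_upwards [hT n] with ω hω m'
      have h1 := hω (toComplex.symm m' + μ)
      rw [Fin.sum_univ_eq_sum_range (fun i => ‖X i ω - T n ω‖),
        Fin.sum_univ_eq_sum_range (fun i => ‖X i ω - (toComplex.symm m' + μ)‖)] at h1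
      have e1 : ∀ i, ‖toComplex (X i ω - μ) - toComplex (T n ω - μ)‖ = ‖X i ω - T n ω‖ := fun i => by
        rw [← map_sub, LinearIsometryEquiv.norm_map]; congr 1; abel
      have e2 : ∀ i, ‖toComplex (X i ω - μ) - m'‖ = ‖X i ω - (toComplex.symm m' + μ)‖ := fun i => by
        conv_lhs => rw [← toComplex.apply_symm_apply m']
        rw [← map_sub, LinearIsometryEquiv.norm_map]; congr 1; abel
      simpa only [e1, e2] using h1)
    measurable_correlationOfSignMean hL
  rw [correlationOfSignMean_signMean hV, asymptoticVariance_eq hV hLsq, ← hρ, ← ha] at hmain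
  refine ⟨?_, ?_⟩
  · filter_upwards [hmain.1] with ω hω
    refine hω.congr' ?_
    filter_upwards [eventually_gt_atTop 0] with n hn
    rw [hρhat, spatialSignCorrelation_sscm hn (fun i => X i ω) (T n ω) μ]
  · refine hmain.2.congr (fun n => .of_forall fun ω => ?_) .rfl
    -- For `n = 0` the reduction to `empMean` is not available (the affine shift `1 / 2` has no
    -- counterpart in an empty average), but the factor `√0` makes both sides `0`.
    rcases Nat.eq_zero_or_pos n with rfl | hn
    · simp
    · simp only
      rw [hρhat, spatialSignCorrelation_sscm hn (fun i => X i ω) (T n ω) μ]
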